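/- **Setting.** Let $(Y,\mathbf X)$ have a joint distribution on $\{1,\dots,h\}\times\mathbb R^p$ such that $\mathbf X$ has finite fourth moments, $\Sigma=\mathrm{Var}(\mathbf X)$ is positive definite and $f_y=\Pr(Y=y)>0$ for every $y$. Let $(Y_i,\mathbf X_i)$, $i=1,2,\dots$, be i.i.d. copies of $(Y,\mathbf X)$. For a positive definite matrix $A$ let $A^{-1/2}$ be the symmetric positive definite square root of $A^{-1}$. For a subspace $\mathcal S$ let $P_{\mathcal S}$ be the orthogonal projection onto $\mathcal S$. *Population.* Let $\mathbf Z=\Sigma^{-1/2}(\mathbf X-\mathrm E\mathbf X)$. Let $\mathcal S_{Y|\mathbf Z}$ be the central subspace, that is, the intersection of all subspaces $\mathcal S$ such that $Y$ and $\mathbf Z$ are conditionally independent given $P_{\mathcal S}\mathbf Z$; it is assumed to have this property itself. Let $d=\dim\mathcal S_{Y|\mathbf Z}$. Let $\boldsymbol\alpha_x$ be a real $p\times r$ matrix of rank $r$, let $\boldsymbol\alpha=\Sigma^{-1/2}\boldsymbol\alpha_x(\boldsymbol\alpha_x^T\Sigma^{-1}\boldsymbol\alpha_x)^{-1/2}$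 and let $\mathcal H=\mathrm{Span}(\boldsymbol\alpha)$. Let $g_y=\sqrt{f_y}$, let $\mathbf D_g=\mathrm{diag}(g_1,\dots,g_h)$, and let $\boldsymbol\mu$ be the $p\times h$ matrix with columns $g_y\mathrm E(\mathbf Z\mid Y=y)$. Let $$\boldsymbol\mu=(\boldsymbol\Gamma_1\ \boldsymbol\Gamma_0)\begin{pmatrix}\mathbf D_s&0\\0&0\end{pmatrix}(\boldsymbol\Psi_1\ \boldsymbol\Psi_0)^T$$ be any singular value decomposition in which $\mathbf D_s$ is a $d\times d$ diagonal matrix with positive diagonal entries, and $(\boldsymbol\Gamma_1\ \boldsymbol\Gamma_0)$ and $(\boldsymbol\Psi_1\ \boldsymbol\Psi_0)$ are orthogonal. Let $J_y$ be the indicator of $Y=y$, let $\boldsymbol\beta_y=\Sigma^{-1}\mathrm{Cov}(\mathbf X,J_y)$, and let $\boldsymbol\varepsilon$ be the vector with entries $\varepsilon_y=J_y-f_y-\boldsymbol\beta_y^T(\mathbf X-\mathrm E\mathbf X)$, $y=1,\dots,h$. *Sample.* From the first $n$ observations let $\bar{\mathbf X}$ be the sample mean and $\hat\Sigma=\frac1n\sum_{i\le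 n}(\mathbf X_i-\bar{\mathbf X})(\mathbf X_i-\bar{\mathbf X})^T$. Let $\hat{\mathbf Z}_i=\hat\Sigma^{-1/2}(\mathbf X_i-\bar{\mathbf X})$. Let $n_y$ be the number of $i\le n$ with $Y_i=y$, let $\hat f_y=n_y/n$, let $\bar{\mathbf Z}_y$ be the average of the $\hat{\mathbf Z}_i$ with $Y_i=y$, and let $\mathbb Z_n$ be the $p\times h$ matrix with columns $\sqrt{\hat f_y}\,\bar{\mathbf Z}_y$. Let $\hat{\boldsymbol\alpha}=\hat\Sigma^{-1/2}\boldsymbol\alpha_x(\boldsymbol\alpha_x^T\hat\Sigma^{-1}\boldsymbol\alpha_x)^{-1/2}$ and $\hat{\mathcal H}=\mathrm{Span}(\hat\Sigma^{-1/2}\boldsymbol\alpha_x)$. Let $\hat L_d$ be the minimum of $\sum_{i\le n}\|\hat{\mathbf Z}_i-\mathbf B\mathbf C_{Y_i}\|^2$ over $p\times d$ matrices $\mathbf B$ with $\mathbf B^T\mathbf B=I_d$ and vectors $\mathbf C_1,\dots,\mathbf C_h\in\mathbb R^d$ with $\sum_y\hat f_y\mathbf C_y=0$. Let $\hat L'_d$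 be the minimum of the same expression under the additional constraint $P_{\hat{\mathcal H}}\mathbf B=0$. The conditional coordinate statistic is $T_n(\mathcal H|d)=\hat L'_d-\hat L_d$. (The sample quantities may be defined arbitrarily, for example by taking inverses of singular matrices to be $0$, on the event that $\hat\Sigma$ is singular, whose probability tends to $0$.) **Theorem 2.** Assume the linearity condition $\mathrm E(\mathbf Z\mid P_{\mathcal S_{Y|\mathbf Z}}\mathbf Z)=P_{\mathcal S_{Y|\mathbf Z}}\mathbf Z$ a.s., the coverage condition $\mathrm{Span}\{\mathrm E(\mathbf Z\mid Y=y):y=1,\dots,h\}=\mathcal S_{Y|\mathbf Z}$, and the coordinate hypothesis $P_{\mathcal H}\mathcal S_{Y|\mathbf Z}=\{0\}$. Then, as $n\to\infty$, $(\boldsymbol\Psi_1^T\otimes I_r)\sqrt n\,\mathrm{vec}(\hat{\boldsymbol\alpha}^T\mathbb Z_n)$ converges in distribution to a normal random vector with mean $0$ and covariance matrix $$\boldsymbol\Omega_{\mathcal H|d}=\mathrm E\bigl(\boldsymbol\Psi_1^T\mathbf D_g^{-1}\boldsymbol\varepsilon\boldsymbol\varepsilon^T\mathbf D_g^{-1}\boldsymbol\Psi_1\otimes\boldsymbol\alpha^T\mathbf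 Z\mathbf Z^T\boldsymbol\alpha\bigr).$$ Consequently $$T_n(\mathcal H|d)\xrightarrow{\ \mathcal L\ }\sum_{i=1}^{dr}\omega_i\chi_i^2(1),$$ where $\omega_1\ge\dots\ge\omega_{dr}$ are the eigenvalues of $\boldsymbol\Omega_{\mathcal H|d}$ and the $\chi_i^2(1)$ are independent chi-squared random variables with one degree of freedom. -/

import Mathlib

open MeasureTheory ProbabilityTheory Filter
open scoped Matrix Kronecker MatrixOrder

noncomputable section

namespace SIR

/-- Real `p`-vectors with the standard inner product. -/
abbrev Vec (p : ℕ) := EuclideanSpace ℝ (Fin p)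

/-- The product `A v` of a matrix and a Euclidean vector. -/
def mulV {p q : ℕ} (A : Matrix (Fin q) (Fin p) ℝ) (v : Vec p) : Vec q :=
  WithLp.toLp 2 (A *ᵥ (WithLp.ofLp v))

/-- `A^{-1/2}`: the symmetric positive semidefinite square root of `A⁻¹`
(used for positive definite `A`; it is `0` for singular `A`). -/
def invSqrt {m : ℕ} (A : Matrix (Fin m) (Fin m) ℝ) : Matrix (Fin m) (Fin m) ℝ :=
  CFC.sqrt A⁻¹

/-- The span of the columns of a matrix. -/
def colSpan {p r : ℕ} (A : Matrix (Fin p) (Fin r) ℝ) : Submodule ℝ (Vec p) :=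
  Submodule.span ℝ (Set.range fun j : Fin r => (WithLp.toLp 2 (A.col j) : Vec p))

/-- The law of a sum of squares of `k` independent standard normal random variables. -/
def chiSquared (k : ℕ) : Measure ℝ :=
  (Measure.pi fun _ : Fin k => gaussianReal 0 1).map fun x => ∑ i, x i ^ 2

instance (k : ℕ) : IsProbabilityMeasure (chiSquared k) :=
  Measure.isProbabilityMeasure_map
    (by fun_prop : Measurable fun x : Fin k → ℝ => ∑ i, x i ^ 2).aemeasurable

/-! ### Dimension reduction subspaces and the central subspace -/

section CentralSubspace

variable {Ω : Type*} [MeasurableSpace Ω] {p h : ℕ}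

theorem measurable_proj_comp {V : Ω → Vec p} (hV : Measurable V) (S : Submodule ℝ (Vec p)) :
    Measurable fun w => S.starProjection (V w) :=
  S.starProjection.continuous.measurable.comp hV

variable [StandardBorelSpace Ω]

/-- `S` is a dimension reduction subspace for the regression of `Y` on the random vector `V`:
`Y` and `V` are conditionally independent given `P_S V`. -/
def IsDimReductionSubspace (μ : Measure Ω) [IsFiniteMeasure μ] {V : Ω → Vec p}
    (hV : Measurable V) (Y : Ω → Fin h) (S : Submodule ℝ (Vec p)) : Prop :=
  CondIndepFun (MeasurableSpace.comap (fun w => S.starProjection (V w)) inferInstance)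
    (measurable_proj_comp hV S).comap_le Y V μ

/-- The intersection of all dimension reduction subspaces. -/
def interDimReduction (μ : Measure Ω) [IsFiniteMeasure μ] {V : Ω → Vec p}
    (hV : Measurable V) (Y : Ω → Fin h) : Submodule ℝ (Vec p) :=
  sInf {S | IsDimReductionSubspace μ hV Y S}

/-- `S` is the central subspace of the regression of `Y` on `V`: it is the intersection of all
dimension reduction subspaces, and is itself a dimension reduction subspace. -/
def IsCentralSubspace (μ : Measure Ω) [IsFiniteMeasure μ] {V : Ω → Vec p}
    (hV : Measurable V) (Y : Ω → Fin h) (S : Submodule ℝ (Vec p)) : Prop :=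
  S = interDimReduction μ hV Y ∧ IsDimReductionSubspace μ hV Y S

end CentralSubspace

/-! ### Population quantities

The population is the joint law `ν` of `(X, Y)` on `ℝ^p × {slices}`; so `X` and `Y` are the two
projections and expectations are integrals against `ν`. -/

section Population

variable {p h r d : ℕ} (ν : Measure (Vec p × Fin h))

/-- `E(X)`. -/
def meanX : Vec p := ∫ w, w.1 ∂ν

/-- `Σ = Var(X)`. -/
def covX : Matrix (Fin p) (Fin p) ℝ :=
  Matrix.of fun i j => cov[fun w => w.1 i, fun w => w.1 j; ν]

/-- `Z = Σ^{-1/2} (X - E(X))`. -/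
def stdZ (w : Vec p × Fin h) : Vec p := mulV (invSqrt (covX ν)) (w.1 - meanX ν)

theorem measurable_stdZ : Measurable (stdZ ν) := by
  have h1 : Measurable fun w : Vec p × Fin h => w.1 - meanX ν := measurable_fst.sub_const _
  have h2 : Continuous (mulV (invSqrt (covX ν))) := by
    unfold mulV
    fun_prop
  exact h2.measurable.comp h1

/-- The event `Y = y`. -/
def slice (y : Fin h) : Set (Vec p × Fin h) := {w | w.2 = y}

/-- `f_y = Pr(Y = y)`. -/
def sliceProb (y : Fin h) : ℝ := ν.real (slice y)

/-- `g_y = √f_y`. -/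
def g (y : Fin h) : ℝ := Real.sqrt (sliceProb ν y)

/-- `D_g`. -/
def Dg : Matrix (Fin h) (Fin h) ℝ := Matrix.diagonal (g ν)

/-- `E(Z | Y = y)`. -/
def condMeanZ (y : Fin h) : Vec p := ∫ w, stdZ ν w ∂(ν[|slice y])

/-- The `p × h` matrix `μ` with columns `g_y E(Z | Y = y)`. -/
def muMat : Matrix (Fin p) (Fin h) ℝ :=
  Matrix.of fun i y => g ν y * condMeanZ ν y i

/-- `J_y`, the indicator of slice `y`. -/
def J (y : Fin h) (w : Vec p × Fin h) : ℝ := if w.2 = y then 1 else 0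

/-- `β_y = Σ⁻¹ Cov(X, J_y)`. -/
def beta (y : Fin h) : Fin p → ℝ :=
  (covX ν)⁻¹ *ᵥ fun i => cov[fun w => w.1 i, J y; ν]

/-- The vector `ε` of population residuals
`ε_y = J_y - f_y - β_yᵀ (X - E(X))` of the linear regressions of `J_y` on `X`. -/
def resid (w : Vec p × Fin h) (y : Fin h) : ℝ :=
  J y w - sliceProb ν y - beta ν y ⬝ᵥ WithLp.ofLp (w.1 - meanX ν)

/-- `α = Σ^{-1/2} α_x (α_xᵀ Σ⁻¹ α_x)^{-1/2}`. -/
def alpha (αx : Matrix (Fin p) (Fin r) ℝ) : Matrix (Fin p) (Fin r) ℝ :=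
  invSqrt (covX ν) * αx * invSqrt (αxᵀ * (covX ν)⁻¹ * αx)

/-- `ℋ = Span(α)`. -/
def hypSpace (αx : Matrix (Fin p) (Fin r) ℝ) : Submodule ℝ (Vec p) := colSpan (alpha ν αx)

/-- The random matrix `Ψ₁ᵀ D_g⁻¹ ε εᵀ D_g⁻¹ Ψ₁ ⊗ αᵀ Z Zᵀ α`. -/
def omegaIntegrand (αx : Matrix (Fin p) (Fin r) ℝ) (Ψ₁ : Matrix (Fin h) (Fin d) ℝ)
    (w : Vec p × Fin h) : Matrix (Fin d × Fin r) (Fin d × Fin r) ℝ :=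
  (Ψ₁ᵀ * (Dg ν)⁻¹ * Matrix.vecMulVec (resid ν w) (resid ν w) * (Dg ν)⁻¹ * Ψ₁) ⊗ₖ
    ((alpha ν αx)ᵀ * Matrix.vecMulVec (WithLp.ofLp (stdZ ν w)) (WithLp.ofLp (stdZ ν w)) *
      alpha ν αx)

/-- `Ω_{ℋ|d}`, the entrywise expectation of the matrix above. -/
def omegaHd (αx : Matrix (Fin p) (Fin r) ℝ) (Ψ₁ : Matrix (Fin h) (Fin d) ℝ) :
    Matrix (Fin d × Fin r) (Fin d × Fin r) ℝ :=
  Matrix.of fun a b => ∫ w, omegaIntegrand ν αx Ψ₁ w a b ∂ν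

/-- Linearity condition `E(Z | P_S Z) = P_S Z` (almost surely). -/
def LinearityCondition (S : Submodule ℝ (Vec p)) : Prop :=
  ν[stdZ ν | MeasurableSpace.comap (fun w => S.starProjection (stdZ ν w)) inferInstance]
    =ᵐ[ν] fun w => S.starProjection (stdZ ν w)

/-- Coverage condition `Span{E(Z | Y = y) : y} = S`. -/
def CoverageCondition (S : Submodule ℝ (Vec p)) : Prop :=
  Submodule.span ℝ (Set.range (condMeanZ ν)) = S

/-- Coordinate hypothesis `P_ℋ S = {0}`. -/
def CoordinateHypothesis (αx : Matrix (Fin p) (Fin r) ℝ) (S : Submodule ℝ (Vec p)) : Prop :=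
  S.map ((hypSpace ν αx).starProjection : Vec p →ₗ[ℝ] Vec p) = ⊥

end Population

/-- `M = (Γ₁ Γ₀) (D_s 0; 0 0) (Ψ₁ Ψ₀)ᵀ` is a singular value decomposition with `d` positive
singular values, where `(Γ₁ Γ₀)` and `(Ψ₁ Ψ₀)` are orthogonal. -/
structure IsSVD {p h d : ℕ} (M : Matrix (Fin p) (Fin h) ℝ)
    (Γ₁ : Matrix (Fin p) (Fin d) ℝ) (Γ₀ : Matrix (Fin p) (Fin (p - d)) ℝ) (s : Fin d → ℝ)
    (Ψ₁ : Matrix (Fin h) (Fin d) ℝ) (Ψ₀ : Matrix (Fin h) (Fin (h - d)) ℝ) : Prop where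
  left_orth : (Matrix.fromCols Γ₁ Γ₀)ᵀ * Matrix.fromCols Γ₁ Γ₀ = 1
  left_orth' : Matrix.fromCols Γ₁ Γ₀ * (Matrix.fromCols Γ₁ Γ₀)ᵀ = 1
  right_orth : (Matrix.fromCols Ψ₁ Ψ₀)ᵀ * Matrix.fromCols Ψ₁ Ψ₀ = 1
  right_orth' : Matrix.fromCols Ψ₁ Ψ₀ * (Matrix.fromCols Ψ₁ Ψ₀)ᵀ = 1
  pos : ∀ i, 0 < s i
  eq : M = Matrix.fromCols Γ₁ Γ₀ *
    (Matrix.fromBlocks (Matrix.diagonal s) 0 0 0 :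
      Matrix (Fin d ⊕ Fin (p - d)) (Fin d ⊕ Fin (h - d)) ℝ) *
    (Matrix.fromCols Ψ₁ Ψ₀)ᵀ

/-! ### Sample quantities, as functions of the data `(x₁, y₁), …, (x_n, y_n)` -/

section Sample

variable {p h r n : ℕ} (x : Fin n → Vec p) (y : Fin n → Fin h)

/-- The sample mean. -/
def meanHat : Vec p := (n : ℝ)⁻¹ • ∑ i, x i

/-- The sample covariance matrix (with divisor `n`). -/
def covHat : Matrix (Fin p) (Fin p) ℝ :=
  (n : ℝ)⁻¹ • ∑ i, Matrix.vecMulVec (WithLp.ofLp (x i - meanHat x))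
    (WithLp.ofLp (x i - meanHat x))

/-- The standardized observations. -/
def zHat (i : Fin n) : Vec p := mulV (invSqrt (covHat x)) (x i - meanHat x)

/-- The number `n_k` of observations in slice `k`. -/
def sliceCount (k : Fin h) : ℕ := (Finset.univ.filter fun i => y i = k).card

/-- The fraction `n_k / n` of observations in slice `k`. -/
def fHat (k : Fin h) : ℝ := (sliceCount y k : ℝ) / n

/-- The average of the standardized observations in slice `k`. -/
def zBar (k : Fin h) : Vec p :=
  (sliceCount y k : ℝ)⁻¹ • ∑ i ∈ Finset.univ.filter (fun i => y i = k), zHat x i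

/-- The `p × h` matrix `ℤ_n` with columns `√(n_k / n)` times the `k`th slice average. -/
def zMat : Matrix (Fin p) (Fin h) ℝ :=
  Matrix.of fun j k => Real.sqrt (fHat y k) * zBar x y k j

/-- The sample version of `α`. -/
def alphaHat (αx : Matrix (Fin p) (Fin r) ℝ) : Matrix (Fin p) (Fin r) ℝ :=
  invSqrt (covHat x) * αx * invSqrt (αxᵀ * (covHat x)⁻¹ * αx)

/-- The sample version of `ℋ`, the span of the sample version of `Σ^{-1/2} α_x`. -/
def hypSpaceHat (αx : Matrix (Fin p) (Fin r) ℝ) : Submodule ℝ (Vec p) :=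
  colSpan (invSqrt (covHat x) * αx)

/-- The least squares loss `L_m(B, C) = ∑_i ‖ẑ_i - B C_{y_i}‖²`. -/
def loss {m : ℕ} (B : Matrix (Fin p) (Fin m) ℝ) (C : Fin h → Vec m) : ℝ :=
  ∑ i, ‖zHat x i - mulV B (C (y i))‖ ^ 2

/-- The residual sum of squares under the dimension constraint: the minimum of `L_m(B, C)` over
semi-orthogonal `B` and over `C` with `∑_k f̂_k C_k = 0`. -/
def rss (m : ℕ) : ℝ :=
  sInf {l | ∃ (B : Matrix (Fin p) (Fin m) ℝ) (C : Fin h → Vec m),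
    Bᵀ * B = 1 ∧ ∑ k, fHat y k • C k = 0 ∧ l = loss x y B C}

/-- The residual sum of squares under the dimension and coordinate constraints: the minimum of
`L_m(B, C)` over `B` and `C` as before that also satisfy `P B = 0`, where `P` is the projection
onto the sample version of `ℋ`. -/
def rssCoord (αx : Matrix (Fin p) (Fin r) ℝ) (m : ℕ) : ℝ :=
  sInf {l | ∃ (B : Matrix (Fin p) (Fin m) ℝ) (C : Fin h → Vec m),
    Bᵀ * B = 1 ∧ ∑ k, fHat y k • C k = 0 ∧
    (∀ j, (hypSpaceHat x αx).starProjection (WithLp.toLp 2 (B.col j)) = 0) ∧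
    l = loss x y B C}

/-- The conditional coordinate statistic `T_n(ℋ|d)`, the difference of the two residual sums of
squares. -/
def condCoordStat (αx : Matrix (Fin p) (Fin r) ℝ) (d : ℕ) : ℝ :=
  rssCoord x y αx d - rss x y d

/-- `(Ψ₁ᵀ ⊗ I_r) √n vec(α̂ᵀ ℤ_n)`. -/
def scaledVec {d : ℕ} (αx : Matrix (Fin p) (Fin r) ℝ) (Ψ₁ : Matrix (Fin h) (Fin d) ℝ) :
    EuclideanSpace ℝ (Fin d × Fin r) :=
  WithLp.toLp 2 ((Ψ₁ᵀ ⊗ₖ (1 : Matrix (Fin r) (Fin r) ℝ)) *ᵥ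
    (Real.sqrt n • ((alphaHat x αx)ᵀ * zMat x y).vec))

end Sample

end SIR

end

/-!
The sample quantities enter only through the sample covariances `Σ̂` of the predictors, the sample
covariances `Ĉ` of the predictors with the slice indicators, and the slice fractions `f̂`:
`ℤ_n = Σ̂^{-1/2} Ĉ D̂⁻¹` with `D̂ = diag(√f̂)` (`SIR.zMat_eq`).

*The normalized matrix.* Hence
`α̂ᵀ ℤ_n = (α_xᵀ Σ̂⁻¹ α_x)^{-1/2} α_xᵀ (Σ̂⁻¹ Ĉ) D̂⁻¹`, where `Σ̂⁻¹ Ĉ` holds the least squares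
coefficients for regressing the indicators on the predictors. By coverage and the coordinate
hypothesis the population coefficients `β` satisfy `α_xᵀ β = 0` (`SIR.transpose_mul_betaMat`), and
`Ĉ - Σ̂ β` is the matrix of sample covariances between the predictors and the residuals `ε`. So
`√n α̂ᵀ ℤ_n` is a continuous function of the normalized sums of `((X - E X) ε, X - E X)` and of
consistent estimates (`SIR.normMat_eq_linearForm`); the central limit theorem and Slutsky's theorem
give its Gaussian limit (`SIR.tendstoInDistribution_normMat`). No differentiation of the matrix
square root is needed, only its continuity.

*The statistic.* Minimizing over the vectors `C_y` and exchanging the roles of rows and columns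
turns both residual sums of squares into `∑ ‖ẑ_i‖² - n φ(M)` with `φ(M) = max ‖M V‖²` over matrices
`V` with `d` orthonormal columns in slice space (`SIR.topEnergy`); here `M = ℤ_n` without the
coordinate constraint and `M = Q̂ ℤ_n`, `Q̂ = 1 - α̂ α̂ᵀ`, with it. Therefore
`T_n = n (φ(ℤ_n) - φ(Q̂ ℤ_n))` (`SIR.condCoordStat_eq`). As `‖ℤ_n V‖² = ‖Q̂ ℤ_n V‖² + ‖α̂ᵀ ℤ_n V‖²`,
inserting a maximizer of either term into the other shows that `T_n` lies between the values of
`n ‖α̂ᵀ ℤ_n V‖²` at the two maximizers. Both `ℤ_n` and `Q̂ ℤ_n` converge to `μ`, which has rank `d`,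
so the column space of each maximizer converges to that of `Ψ₁`
(`SIR.frobSq_proj_sub_le_of_maximizer`), and `T_n` differs from the squared norm of
`√n vec(α̂ᵀ ℤ_n Ψ₁)` by a term that vanishes in probability (`SIR.abs_condCoordStat_sub_le`). The
squared norm of the Gaussian limit is the weighted sum of chi-squared variables
(`SIR.map_norm_sq_multivariateGaussian`).
-/

noncomputable section

namespace SIR

open Topology

/-! ### Frobenius norms and matrices with orthonormal columns -/

section Frobenius

variable {k l m q : Type*} [Fintype k] [Fintype l] [Fintype m] [Fintype q]

/-- The squared Frobenius norm of a real matrix. -/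
def frobSq (M : Matrix k l ℝ) : ℝ := ∑ i, ∑ j, M i j ^ 2

theorem frobSq_nonneg (M : Matrix k l ℝ) : 0 ≤ frobSq M :=
  Finset.sum_nonneg fun _ _ => Finset.sum_nonneg fun _ _ => sq_nonneg _

theorem frobSq_eq_trace (M : Matrix k l ℝ) : frobSq M = (Mᵀ * M).trace := by
  simp only [frobSq, Matrix.trace, Matrix.diag, Matrix.mul_apply, Matrix.transpose_apply]
  rw [Finset.sum_comm]
  simp [sq]

theorem frobSq_transpose (M : Matrix k l ℝ) : frobSq Mᵀ = frobSq M := by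
  simp only [frobSq, Matrix.transpose_apply]
  rw [Finset.sum_comm]

theorem frobSq_smul (c : ℝ) (M : Matrix k l ℝ) : frobSq (c • M) = c ^ 2 * frobSq M := by
  simp [frobSq, Finset.mul_sum, mul_pow]

theorem sq_le_frobSq (M : Matrix k l ℝ) (i : k) (j : l) : M i j ^ 2 ≤ frobSq M := by
  refine le_trans ?_ (Finset.single_le_sum (f := fun i => ∑ j, M i j ^ 2)
    (fun i _ => Finset.sum_nonneg fun _ _ => sq_nonneg _) (Finset.mem_univ i))
  exact Finset.single_le_sum (f := fun j => M i j ^ 2) (fun _ _ => sq_nonneg _)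
    (Finset.mem_univ j)

theorem abs_le_sqrt_frobSq (M : Matrix k l ℝ) (i : k) (j : l) : |M i j| ≤ √(frobSq M) :=
  Real.abs_le_sqrt (sq_le_frobSq M i j)

/-- Multiplication by a matrix with orthonormal columns preserves the Frobenius norm. -/
theorem frobSq_mul_left [DecidableEq l] {V : Matrix k l ℝ} (hV : Vᵀ * V = 1) (M : Matrix l m ℝ) :
    frobSq (V * M) = frobSq M := by
  rw [frobSq_eq_trace, frobSq_eq_trace, Matrix.transpose_mul, Matrix.mul_assoc,
    ← Matrix.mul_assoc Vᵀ, hV, Matrix.one_mul]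

/-- Pythagoras for the projection `V Vᵀ` onto the column space of `V`. -/
theorem frobSq_eq_add [DecidableEq l] [DecidableEq k] {V : Matrix k l ℝ} (hV : Vᵀ * V = 1)
    (M : Matrix k m ℝ) :
    frobSq M = frobSq (Vᵀ * M) + frobSq ((1 - V * Vᵀ) * M) := by
  have h1 : (1 - V * Vᵀ)ᵀ * (1 - V * Vᵀ) = 1 - V * Vᵀ := by
    have : V * Vᵀ * (V * Vᵀ) = V * Vᵀ := by
      rw [Matrix.mul_assoc, ← Matrix.mul_assoc Vᵀ, hV, Matrix.one_mul]
    simp [Matrix.transpose_sub, Matrix.transpose_mul, Matrix.sub_mul, Matrix.mul_sub, this]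
  have h2 : ((1 - V * Vᵀ) * M)ᵀ * ((1 - V * Vᵀ) * M) = Mᵀ * M - Mᵀ * (V * Vᵀ) * M := by
    rw [Matrix.transpose_mul, Matrix.mul_assoc, ← Matrix.mul_assoc _ (1 - V * Vᵀ) M, h1,
      ← Matrix.mul_assoc, Matrix.mul_sub, Matrix.sub_mul, Matrix.mul_one]
  have h3 : (Vᵀ * M)ᵀ * (Vᵀ * M) = Mᵀ * (V * Vᵀ) * M := by
    simp [Matrix.transpose_mul, Matrix.mul_assoc]
  rw [frobSq_eq_trace, frobSq_eq_trace, frobSq_eq_trace, h2, h3, Matrix.trace_sub]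
  ring

theorem frobSq_transpose_mul_le [DecidableEq l] [DecidableEq k] {V : Matrix k l ℝ}
    (hV : Vᵀ * V = 1) (M : Matrix k m ℝ) : frobSq (Vᵀ * M) ≤ frobSq M := by
  rw [frobSq_eq_add hV M]
  linarith [frobSq_nonneg ((1 - V * Vᵀ) * M)]

theorem frobSq_mul_right_le [DecidableEq l] [DecidableEq k] {V : Matrix k l ℝ}
    (hV : Vᵀ * V = 1) (M : Matrix m k ℝ) : frobSq (M * V) ≤ frobSq M := by
  rw [← frobSq_transpose (M * V), ← frobSq_transpose M, Matrix.transpose_mul]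
  exact frobSq_transpose_mul_le hV _

theorem frobSq_of_orthonormal [DecidableEq l] {V : Matrix k l ℝ} (hV : Vᵀ * V = 1) :
    frobSq V = Fintype.card l := by
  rw [frobSq_eq_trace, hV, Matrix.trace_one]

theorem continuous_frobSq : Continuous (frobSq : Matrix k l ℝ → ℝ) := by
  unfold frobSq
  fun_prop

/-- The entries of the projection matrix `V Vᵀ` are bounded by `1`. -/
theorem abs_mul_transpose_le_one [DecidableEq l] {V : Matrix k l ℝ} (hV : Vᵀ * V = 1)
    (i j : k) : |(V * Vᵀ) i j| ≤ 1 := by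
  classical
  have hidem : V * Vᵀ * (V * Vᵀ) = V * Vᵀ := by
    rw [Matrix.mul_assoc, ← Matrix.mul_assoc Vᵀ, hV, Matrix.one_mul]
  have hsymm : ∀ a b, (V * Vᵀ) a b = (V * Vᵀ) b a := fun a b => by
    simp [Matrix.mul_apply, mul_comm]
  have hdiag : ∀ a, (V * Vᵀ) a a = ∑ b, (V * Vᵀ) a b ^ 2 := fun a => by
    conv_lhs => rw [← hidem, Matrix.mul_apply]
    exact Finset.sum_congr rfl fun b _ => by rw [hsymm b a, sq]
  have hle : ∀ a b, (V * Vᵀ) a b ^ 2 ≤ (V * Vᵀ) a a := fun a b => by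
    rw [hdiag a]
    exact Finset.single_le_sum (f := fun b => (V * Vᵀ) a b ^ 2) (fun _ _ => sq_nonneg _)
      (Finset.mem_univ b)
  have h1 : (V * Vᵀ) i i ≤ 1 := by nlinarith [hle i i]
  exact abs_le_one_iff_mul_self_le_one.2 (by nlinarith [hle i j])

end Frobenius

/-! ### Extending to orthonormal columns -/

theorem _root_.Submodule.exists_between_finrank_eq {E : Type*} [AddCommGroup E] [Module ℝ E]
    [FiniteDimensional ℝ E] {L K : Submodule ℝ E} (hLK : L ≤ K) {d : ℕ}
    (h1 : Module.finrank ℝ L ≤ d) (h2 : d ≤ Module.finrank ℝ K) :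
    ∃ N : Submodule ℝ E, L ≤ N ∧ N ≤ K ∧ Module.finrank ℝ N = d := by
  induction d, h1 using Nat.le_induction with
  | base => exact ⟨L, le_rfl, hLK, rfl⟩
  | succ d hd ih =>
    obtain ⟨N, hLN, hNK, hN⟩ := ih (by omega)
    have hlt : N < K := lt_of_le_of_ne hNK fun h => by subst h; omega
    obtain ⟨v, hvK, hvN⟩ := SetLike.exists_of_lt hlt
    refine ⟨N ⊔ Submodule.span ℝ {v}, hLN.trans le_sup_left,
      sup_le hNK ((Submodule.span_singleton_le_iff_mem v K).2 hvK), ?_⟩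
    have hv0 : v ≠ 0 := fun h => hvN (h ▸ N.zero_mem)
    have hdisj : N ⊓ Submodule.span ℝ {v} = ⊥ := by
      refine (Submodule.disjoint_span_singleton' hv0).2 hvN |>.eq_bot
    have := Submodule.finrank_sup_add_finrank_inf_eq N (Submodule.span ℝ {v})
    rw [hdisj, finrank_bot, finrank_span_singleton hv0] at this
    omega

/-- Any matrix `N` with `d` columns in the kernel of `A` factors through a matrix with `d`
orthonormal columns in that kernel, provided the kernel has dimension at least `d`. -/
theorem exists_orthonormal_cols {a q d : ℕ} (A : Matrix (Fin a) (Fin q) ℝ) (hd : d + a ≤ q)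
    (N : Matrix (Fin q) (Fin d) ℝ) (hN : A * N = 0) :
    ∃ V : Matrix (Fin q) (Fin d) ℝ, Vᵀ * V = 1 ∧ A * V = 0 ∧ V * (Vᵀ * N) = N := by
  let f : Vec q →ₗ[ℝ] Vec a := Matrix.toEuclideanLin A
  have hf : ∀ v i, f v i = ∑ j, A i j * v j := fun v i => by
    simp [f, Matrix.toLpLin_apply, Matrix.mulVec, dotProduct]
  let c : Fin d → Vec q := fun j => WithLp.toLp 2 (N.col j)
  have hcK : Submodule.span ℝ (Set.range c) ≤ LinearMap.ker f := by
    rw [Submodule.span_le]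
    rintro _ ⟨j, rfl⟩
    rw [SetLike.mem_coe, LinearMap.mem_ker]
    ext i
    rw [hf]
    simpa [Matrix.mul_apply, c] using congrFun (congrFun hN i) j
  have hker : d ≤ Module.finrank ℝ (LinearMap.ker f) := by
    have h1 := LinearMap.finrank_range_add_finrank_ker f
    have h2 : Module.finrank ℝ (LinearMap.range f) ≤ a := by
      simpa using Submodule.finrank_le (LinearMap.range f)
    rw [finrank_euclideanSpace_fin] at h1
    omega
  have hspan : Module.finrank ℝ (Submodule.span ℝ (Set.range c)) ≤ d := by
    simpa [Set.finrank] using finrank_range_le_card (R := ℝ) c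
  obtain ⟨L, hL1, hL2, hL3⟩ := Submodule.exists_between_finrank_eq hcK hspan hker
  let b : OrthonormalBasis (Fin d) ℝ L :=
    (stdOrthonormalBasis ℝ L).reindex (finCongr hL3)
  let V : Matrix (Fin q) (Fin d) ℝ := Matrix.of fun i j => (b j : Vec q) i
  refine ⟨V, ?_, ?_, ?_⟩
  · ext j k
    have := orthonormal_iff_ite.1 b.orthonormal j k
    rw [Submodule.coe_inner, PiLp.inner_apply] at this
    simp only [Matrix.mul_apply, Matrix.transpose_apply, V, Matrix.of_apply, Matrix.one_apply]
    rw [← this]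
    exact Finset.sum_congr rfl fun i _ => by simp [mul_comm]
  · ext i j
    have : f (b j) = 0 := hL2 (b j).2
    have := congrArg (fun v : Vec a => v i) this
    simpa [hf, Matrix.mul_apply, V] using this
  · ext i j
    have hmem : c j ∈ L := hL1 (Submodule.subset_span ⟨j, rfl⟩)
    have h1 := b.sum_repr' ⟨c j, hmem⟩
    have h2 := congrArg (fun v : L => (v : Vec q) i) h1
    simp only [Submodule.coe_sum, Submodule.coe_smul, Submodule.coe_inner, PiLp.inner_apply,
      WithLp.ofLp_sum, Finset.sum_apply, WithLp.ofLp_smul, Pi.smul_apply, smul_eq_mul] at h2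
    rw [show N i j = (c j) i from rfl, ← h2, Matrix.mul_apply]
    refine Finset.sum_congr rfl fun k _ => ?_
    rw [mul_comm, Matrix.mul_apply]
    congr 1
    exact Finset.sum_congr rfl fun l _ => by simp [V, c, mul_comm]

/-! ### The energy captured by the best `d`-dimensional projection -/

/-- The `q × d` matrices with orthonormal columns. -/
def stiefel (q d : ℕ) : Set (Matrix (Fin q) (Fin d) ℝ) := {V | Vᵀ * V = 1}

theorem stiefel_nonempty {q d : ℕ} (h : d ≤ q) : (stiefel q d).Nonempty := by
  obtain ⟨V, hV, -⟩ := exists_orthonormal_cols (0 : Matrix (Fin 0) (Fin q) ℝ) (by omega)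
    (0 : Matrix (Fin q) (Fin d) ℝ) (Matrix.zero_mul _)
  exact ⟨V, hV⟩

theorem isCompact_stiefel (q d : ℕ) : IsCompact (stiefel q d) := by
  have hsub : stiefel q d ⊆
      Set.pi Set.univ fun _ : Fin q => Set.pi Set.univ fun _ : Fin d =>
        Set.Icc (-(d + 1 : ℝ)) (d + 1) := by
    intro V hV i _ j _
    have h1 : V i j ^ 2 ≤ d := by
      simpa using (sq_le_frobSq V i j).trans_eq (frobSq_of_orthonormal hV)
    have hd : (0 : ℝ) ≤ d := Nat.cast_nonneg d
    exact abs_le.1 (abs_le_of_sq_le_sq (by nlinarith) (by positivity))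
  refine IsCompact.of_isClosed_subset
    (isCompact_univ_pi fun _ => isCompact_univ_pi fun _ => isCompact_Icc) ?_ hsub
  have hc : Continuous fun V : Matrix (Fin q) (Fin d) ℝ => Vᵀ * V := by fun_prop
  exact isClosed_singleton.preimage hc

/-- The largest value of `‖M V‖²` over matrices `V` with `d` orthonormal columns: the sum of the
`d` largest eigenvalues of `Mᵀ M`. -/
def topEnergy {p h : ℕ} (d : ℕ) (M : Matrix (Fin p) (Fin h) ℝ) : ℝ :=
  sSup ((fun V => frobSq (M * V)) '' stiefel h d)

section TopEnergy

variable {p h d a : ℕ}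

theorem continuous_topEnergy : Continuous (topEnergy d : Matrix (Fin p) (Fin h) ℝ → ℝ) := by
  unfold topEnergy
  refine (isCompact_stiefel h d).continuous_sSup
    (f := fun (M : Matrix (Fin p) (Fin h) ℝ) V => frobSq (M * V)) ?_
  have hc : Continuous fun x : Matrix (Fin p) (Fin h) ℝ × Matrix (Fin h) (Fin d) ℝ =>
    x.1 * x.2 := by fun_prop
  exact continuous_frobSq.comp hc

theorem continuous_frobSq_mul (M : Matrix (Fin p) (Fin h) ℝ) :
    Continuous fun V : Matrix (Fin h) (Fin d) ℝ => frobSq (M * V) :=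
  continuous_frobSq.comp (by fun_prop)

theorem frobSq_mul_le_topEnergy (M : Matrix (Fin p) (Fin h) ℝ) {V : Matrix (Fin h) (Fin d) ℝ}
    (hV : Vᵀ * V = 1) : frobSq (M * V) ≤ topEnergy d M :=
  le_csSup ((isCompact_stiefel h d).image (continuous_frobSq_mul M)).bddAbove ⟨V, hV, rfl⟩

theorem exists_topEnergy_eq (hd : d ≤ h) (M : Matrix (Fin p) (Fin h) ℝ) :
    ∃ V : Matrix (Fin h) (Fin d) ℝ, Vᵀ * V = 1 ∧ topEnergy d M = frobSq (M * V) := by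
  obtain ⟨V, hV, h1⟩ := ((isCompact_stiefel h d).image (continuous_frobSq_mul M)).sSup_mem
    ((stiefel_nonempty hd).image _)
  exact ⟨V, hV, h1.symm⟩

/-- Compressing the rows of `M` to `d` dimensions captures no more than the best compression of
its columns. -/
theorem frobSq_transpose_mul_le_topEnergy (hd : d ≤ h) (M : Matrix (Fin p) (Fin h) ℝ)
    {B : Matrix (Fin p) (Fin d) ℝ} (hB : Bᵀ * B = 1) : frobSq (Bᵀ * M) ≤ topEnergy d M := by
  obtain ⟨V, hV, -, hVN⟩ := exists_orthonormal_cols (0 : Matrix (Fin 0) (Fin h) ℝ) (by omega)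
    (Mᵀ * B) (Matrix.zero_mul _)
  refine le_trans ?_ (frobSq_mul_le_topEnergy M hV)
  calc frobSq (Bᵀ * M) = frobSq (Mᵀ * B) := by
        rw [← frobSq_transpose, Matrix.transpose_mul, Matrix.transpose_transpose]
    _ = frobSq (Vᵀ * (Mᵀ * B)) := by
        conv_lhs => rw [← hVN]
        exact frobSq_mul_left hV _
    _ = frobSq (Bᵀ * (M * V)) := by
        rw [← frobSq_transpose]
        simp [Matrix.transpose_mul, Matrix.mul_assoc]
    _ ≤ frobSq (M * V) := frobSq_transpose_mul_le hB _

/-- If the columns of `M` lie in the kernel of `A`, the best compression of the columns of `M` is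
matched by a compression of its rows with basis in the kernel of `A`. -/
theorem exists_topEnergy_le (hd : d ≤ h) (A : Matrix (Fin a) (Fin p) ℝ) (hda : d + a ≤ p)
    (M : Matrix (Fin p) (Fin h) ℝ) (hA : A * M = 0) :
    ∃ B : Matrix (Fin p) (Fin d) ℝ, Bᵀ * B = 1 ∧ A * B = 0 ∧ topEnergy d M ≤ frobSq (Bᵀ * M) := by
  obtain ⟨V, hV, hVM⟩ := exists_topEnergy_eq hd M
  obtain ⟨B, hB, hAB, hBN⟩ := exists_orthonormal_cols A hda (M * V)
    (by rw [← Matrix.mul_assoc, hA, Matrix.zero_mul])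
  refine ⟨B, hB, hAB, ?_⟩
  calc topEnergy d M = frobSq (M * V) := hVM
    _ = frobSq (Bᵀ * (M * V)) := by
        conv_lhs => rw [← hBN]
        exact frobSq_mul_left hB _
    _ = frobSq (Bᵀ * M * V) := by rw [Matrix.mul_assoc]
    _ ≤ frobSq (Bᵀ * M) := frobSq_mul_right_le hV _

end TopEnergy

/-! ### Stability of the best right projection -/

section Stability

variable {p h d : ℕ} {k : Type*} [Fintype k]

/-- The entrywise `ℓ¹` norm of `MᵀM - NᵀN`. -/
def gramDist (M N : Matrix (Fin p) (Fin h) ℝ) : ℝ :=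
  ∑ i, ∑ j, |(Mᵀ * M) i j - (Nᵀ * N) i j|

theorem gramDist_nonneg (M N : Matrix (Fin p) (Fin h) ℝ) : 0 ≤ gramDist M N :=
  Finset.sum_nonneg fun _ _ => Finset.sum_nonneg fun _ _ => abs_nonneg _

theorem continuous_gramDist_left (N : Matrix (Fin p) (Fin h) ℝ) :
    Continuous fun M : Matrix (Fin p) (Fin h) ℝ => gramDist M N := by
  unfold gramDist
  refine continuous_finsetSum _ fun i _ => continuous_finsetSum _ fun j _ => ?_
  have hc : Continuous fun M : Matrix (Fin p) (Fin h) ℝ => Mᵀ * M := by fun_prop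
  exact ((hc.matrix_elem i j).sub continuous_const).abs

theorem gramDist_self (N : Matrix (Fin p) (Fin h) ℝ) : gramDist N N = 0 := by
  simp [gramDist]

theorem frobSq_mul_eq_sum {l m : Type*} [Fintype l] [Fintype m] (M : Matrix k l ℝ)
    (V : Matrix l m ℝ) :
    frobSq (M * V) = ∑ i, ∑ j, (Mᵀ * M) i j * (V * Vᵀ) i j := by
  have h1 : ∀ i j, (V * Vᵀ) i j = (V * Vᵀ) j i := fun i j => by
    simp [Matrix.mul_apply, mul_comm]
  rw [frobSq_eq_trace, Matrix.transpose_mul, Matrix.mul_assoc, Matrix.trace_mul_comm,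
    ← Matrix.mul_assoc, Matrix.mul_assoc (Mᵀ * M), Matrix.trace]
  refine Finset.sum_congr rfl fun i _ => ?_
  rw [Matrix.diag_apply, Matrix.mul_apply]
  exact Finset.sum_congr rfl fun j _ => by rw [h1]

theorem abs_frobSq_mul_sub_le (M N : Matrix (Fin p) (Fin h) ℝ) {V : Matrix (Fin h) (Fin d) ℝ}
    (hV : Vᵀ * V = 1) : |frobSq (M * V) - frobSq (N * V)| ≤ gramDist M N := by
  rw [frobSq_mul_eq_sum, frobSq_mul_eq_sum, ← Finset.sum_sub_distrib]
  refine (Finset.abs_sum_le_sum_abs _ _).trans (Finset.sum_le_sum fun i _ => ?_)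
  rw [← Finset.sum_sub_distrib]
  refine (Finset.abs_sum_le_sum_abs _ _).trans (Finset.sum_le_sum fun j _ => ?_)
  rw [← sub_mul, abs_mul]
  exact mul_le_of_le_one_right (abs_nonneg _) (abs_mul_transpose_le_one hV i j)

/-- `‖V Vᵀ - U Uᵀ‖² = 2 (d - ‖Uᵀ V‖²)` for matrices with `d` orthonormal columns. -/
theorem frobSq_proj_sub {U V : Matrix (Fin h) (Fin d) ℝ} (hU : Uᵀ * U = 1) (hV : Vᵀ * V = 1) :
    frobSq (V * Vᵀ - U * Uᵀ) = 2 * (d - frobSq (Uᵀ * V)) := by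
  have h1 : (V * Vᵀ) * (V * Vᵀ) = V * Vᵀ := by
    rw [Matrix.mul_assoc, ← Matrix.mul_assoc Vᵀ, hV, Matrix.one_mul]
  have h2 : (U * Uᵀ) * (U * Uᵀ) = U * Uᵀ := by
    rw [Matrix.mul_assoc, ← Matrix.mul_assoc Uᵀ, hU, Matrix.one_mul]
  have h3 : (V * Vᵀ).trace = d := by rw [Matrix.trace_mul_comm, hV, Matrix.trace_one]; simp
  have h4 : (U * Uᵀ).trace = d := by rw [Matrix.trace_mul_comm, hU, Matrix.trace_one]; simp
  have h5 : (U * Uᵀ * (V * Vᵀ)).trace = frobSq (Uᵀ * V) := by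
    rw [frobSq_eq_trace, Matrix.transpose_mul, Matrix.transpose_transpose, ← Matrix.mul_assoc,
      Matrix.trace_mul_comm]
    simp only [Matrix.mul_assoc]
  have h6 : (V * Vᵀ * (U * Uᵀ)).trace = frobSq (Uᵀ * V) := by rw [Matrix.trace_mul_comm, h5]
  rw [frobSq_eq_trace, Matrix.transpose_sub, Matrix.transpose_mul, Matrix.transpose_mul,
    Matrix.transpose_transpose, Matrix.transpose_transpose, Matrix.sub_mul, Matrix.mul_sub,
    Matrix.mul_sub, h1, h2, Matrix.trace_sub, Matrix.trace_sub, Matrix.trace_sub, h3, h4, h5, h6]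
  ring

theorem abs_frobSq_mul_sub_proj_le (W : Matrix k (Fin h) ℝ) (U V : Matrix (Fin h) (Fin d) ℝ) :
    |frobSq (W * V) - frobSq (W * U)| ≤
      h ^ 2 * frobSq W * √(frobSq (V * Vᵀ - U * Uᵀ)) := by
  have hW : ∀ i j, |(Wᵀ * W) i j| ≤ frobSq W := fun i j => by
    rw [Matrix.mul_apply]
    refine (Finset.abs_sum_le_sum_abs _ _).trans ?_
    rw [frobSq]
    refine Finset.sum_le_sum fun l _ => ?_
    rw [Matrix.transpose_apply, abs_mul]
    have hi := Finset.single_le_sum (f := fun j => W l j ^ 2) (fun _ _ => sq_nonneg _)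
      (Finset.mem_univ i)
    have hj := Finset.single_le_sum (f := fun j => W l j ^ 2) (fun _ _ => sq_nonneg _)
      (Finset.mem_univ j)
    have := two_mul_le_add_sq |W l i| |W l j|
    rw [sq_abs, sq_abs] at this
    linarith
  rw [frobSq_mul_eq_sum, frobSq_mul_eq_sum, ← Finset.sum_sub_distrib]
  have hb : ∀ i j, |(Wᵀ * W) i j * (V * Vᵀ) i j - (Wᵀ * W) i j * (U * Uᵀ) i j| ≤
      frobSq W * √(frobSq (V * Vᵀ - U * Uᵀ)) := fun i j => by
    rw [← mul_sub, abs_mul, ← Matrix.sub_apply]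
    exact mul_le_mul (hW i j) (abs_le_sqrt_frobSq _ i j) (abs_nonneg _) (frobSq_nonneg _)
  calc |∑ i, (∑ j, (Wᵀ * W) i j * (V * Vᵀ) i j - ∑ j, (Wᵀ * W) i j * (U * Uᵀ) i j)|
      ≤ ∑ i : Fin h, ∑ j : Fin h, frobSq W * √(frobSq (V * Vᵀ - U * Uᵀ)) := by
        refine (Finset.abs_sum_le_sum_abs _ _).trans (Finset.sum_le_sum fun i _ => ?_)
        rw [← Finset.sum_sub_distrib]
        exact (Finset.abs_sum_le_sum_abs _ _).trans (Finset.sum_le_sum fun j _ => hb i j)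
    _ = _ := by simp; ring

/-- If `μ = Γ diag(s) Uᵀ` has rank `d` with squared singular values at least `c`, then every
maximizer `V` of `‖M V‖²`, for `M` with Gram matrix close to that of `μ`, has a column space close
to that of `U`. -/
theorem frobSq_proj_sub_le_of_maximizer {μ M : Matrix (Fin p) (Fin h) ℝ}
    {Γ : Matrix (Fin p) (Fin d) ℝ} (hΓ : Γᵀ * Γ = 1) {s : Fin d → ℝ} {c : ℝ} (hc : 0 < c)
    (hs : ∀ i, c ≤ s i ^ 2) {U V : Matrix (Fin h) (Fin d) ℝ} (hU : Uᵀ * U = 1)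
    (hμ : μ = Γ * Matrix.diagonal s * Uᵀ) (hV : Vᵀ * V = 1)
    (hmax : topEnergy d M = frobSq (M * V)) :
    frobSq (V * Vᵀ - U * Uᵀ) ≤ 4 / c * gramDist M μ := by
  -- the energy of `μ` lost by projecting on `V` controls the distance of the projections
  have key : ∀ T : Matrix (Fin h) (Fin d) ℝ, frobSq (μ * T) =
      ∑ i, s i ^ 2 * ∑ j, (Uᵀ * T) i j ^ 2 := fun T => by
    rw [hμ, Matrix.mul_assoc, Matrix.mul_assoc, frobSq_mul_left hΓ, frobSq]
    simp [Matrix.diagonal_mul, mul_pow, Finset.mul_sum]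
  have hrow : ∀ i, ∑ j, (Uᵀ * V) i j ^ 2 ≤ 1 := fun i => by
    have h1 := frobSq_transpose_mul_le hV (Matrix.of fun (l : Fin h) (_ : Fin 1) => U l i)
    have h2 : frobSq (Matrix.of fun (l : Fin h) (_ : Fin 1) => U l i) = 1 := by
      have := congrFun (congrFun hU i) i
      simpa [frobSq, Matrix.mul_apply, sq] using this
    rw [h2] at h1
    refine le_of_eq_of_le ?_ h1
    simp only [frobSq, Finset.univ_unique, Finset.sum_singleton, Matrix.mul_apply,
      Matrix.transpose_apply, Matrix.of_apply]
    exact Finset.sum_congr rfl fun j _ => by simp [mul_comm]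
  have hgap : c * (d - frobSq (Uᵀ * V)) ≤ frobSq (μ * U) - frobSq (μ * V) := by
    have e1 : c * (d - frobSq (Uᵀ * V)) = ∑ i, c * (1 - ∑ j, (Uᵀ * V) i j ^ 2) := by
      rw [← Finset.mul_sum, Finset.sum_sub_distrib, frobSq]
      simp
    have e2 : ∀ i, ∑ j, (Uᵀ * U) i j ^ 2 = 1 := fun i => by
      rw [hU]; simp [Matrix.one_apply]
    rw [e1, key, key, ← Finset.sum_sub_distrib]
    refine Finset.sum_le_sum fun i _ => ?_
    rw [e2, ← mul_sub]
    exact mul_le_mul_of_nonneg_right (hs i) (sub_nonneg.2 (hrow i))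
  have h1 := abs_le.1 (abs_frobSq_mul_sub_le M μ hU)
  have h2 := abs_le.1 (abs_frobSq_mul_sub_le M μ hV)
  have h3 : frobSq (M * U) ≤ frobSq (M * V) := hmax ▸ frobSq_mul_le_topEnergy M hU
  have h4 : c * (d - frobSq (Uᵀ * V)) ≤ 2 * gramDist M μ := by linarith [h1.2, h1.1, h2.1, h2.2]
  rw [frobSq_proj_sub hU hV, div_mul_eq_mul_div, le_div_iff₀ hc]
  linarith

/-- If `A Aᵀ` is a projection, the drop in energy caused by applying the complementary projection
`1 - A Aᵀ` to the columns of `M` is, up to a small error, the energy of `Aᵀ M U`. The case `A = 0`,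
where both sides vanish, is included. -/
theorem abs_topEnergy_sub_le {r : ℕ} (hd : d ≤ h) {μ M : Matrix (Fin p) (Fin h) ℝ}
    {A : Matrix (Fin p) (Fin r) ℝ} (hA : A * Aᵀ * (A * Aᵀ) = A * Aᵀ)
    {Γ : Matrix (Fin p) (Fin d) ℝ} (hΓ : Γᵀ * Γ = 1) {s : Fin d → ℝ} {c : ℝ} (hc : 0 < c)
    (hs : ∀ i, c ≤ s i ^ 2) {U : Matrix (Fin h) (Fin d) ℝ} (hU : Uᵀ * U = 1)
    (hμ : μ = Γ * Matrix.diagonal s * Uᵀ) :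
    |topEnergy d M - topEnergy d ((1 - A * Aᵀ) * M) - frobSq (Aᵀ * M * U)| ≤
      h ^ 2 * frobSq (Aᵀ * M) *
        √(4 / c * (gramDist M μ + gramDist ((1 - A * Aᵀ) * M) μ)) := by
  have hsplit : ∀ V : Matrix (Fin h) (Fin d) ℝ,
      frobSq (M * V) = frobSq ((1 - A * Aᵀ) * M * V) + frobSq (Aᵀ * M * V) := fun V => by
    have hQ : (1 - A * Aᵀ)ᵀ * (1 - A * Aᵀ) = 1 - A * Aᵀ := by
      simp [Matrix.transpose_sub, Matrix.transpose_mul, Matrix.sub_mul, Matrix.mul_sub, hA]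
    have e1 : ((1 - A * Aᵀ) * (M * V))ᵀ * ((1 - A * Aᵀ) * (M * V)) =
        (M * V)ᵀ * (M * V) - (M * V)ᵀ * (A * Aᵀ) * (M * V) := by
      rw [Matrix.transpose_mul, Matrix.mul_assoc, ← Matrix.mul_assoc _ (1 - A * Aᵀ), hQ,
        ← Matrix.mul_assoc, Matrix.mul_sub, Matrix.sub_mul, Matrix.mul_one]
    have e2 : (Aᵀ * (M * V))ᵀ * (Aᵀ * (M * V)) = (M * V)ᵀ * (A * Aᵀ) * (M * V) := by
      rw [Matrix.transpose_mul Aᵀ]; simp [Matrix.mul_assoc]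
    rw [Matrix.mul_assoc, Matrix.mul_assoc, frobSq_eq_trace, frobSq_eq_trace, frobSq_eq_trace,
      e1, e2, Matrix.trace_sub]
    ring
  have hg1 := gramDist_nonneg M μ
  have hg2 := gramDist_nonneg ((1 - A * Aᵀ) * M) μ
  have hc4 : 0 ≤ 4 / c := by positivity
  have bound : ∀ V : Matrix (Fin h) (Fin d) ℝ,
      frobSq (V * Vᵀ - U * Uᵀ) ≤ 4 / c * (gramDist M μ + gramDist ((1 - A * Aᵀ) * M) μ) →
      |frobSq (Aᵀ * M * V) - frobSq (Aᵀ * M * U)| ≤ h ^ 2 * frobSq (Aᵀ * M) *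
        √(4 / c * (gramDist M μ + gramDist ((1 - A * Aᵀ) * M) μ)) := fun V hV =>
    (abs_frobSq_mul_sub_proj_le (Aᵀ * M) U V).trans
      (mul_le_mul_of_nonneg_left (Real.sqrt_le_sqrt hV)
        (mul_nonneg (by positivity) (frobSq_nonneg _)))
  obtain ⟨V, hV, hVmax⟩ := exists_topEnergy_eq hd M
  obtain ⟨V', hV', hVmax'⟩ := exists_topEnergy_eq hd ((1 - A * Aᵀ) * M)
  have b1 := bound V ((frobSq_proj_sub_le_of_maximizer hΓ hc hs hU hμ hV hVmax).trans
    (mul_le_mul_of_nonneg_left (by linarith) hc4))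
  have b2 := bound V' ((frobSq_proj_sub_le_of_maximizer hΓ hc hs hU hμ hV' hVmax').trans
    (mul_le_mul_of_nonneg_left (by linarith) hc4))
  -- the drop lies between the energies of `Aᵀ M` along the two maximizers
  have u1 : topEnergy d M - topEnergy d ((1 - A * Aᵀ) * M) ≤ frobSq (Aᵀ * M * V) := by
    have := frobSq_mul_le_topEnergy ((1 - A * Aᵀ) * M) hV
    have := hsplit V
    linarith
  have u2 : frobSq (Aᵀ * M * V') ≤ topEnergy d M - topEnergy d ((1 - A * Aᵀ) * M) := by
    have := frobSq_mul_le_topEnergy M hV'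
    have := hsplit V'
    linarith
  rw [abs_le] at b1 b2 ⊢
  constructor <;> linarith [b1.1, b1.2, b2.1, b2.2]

end Stability

/-! ### Inverse square roots -/

section InvSqrt

variable {m : ℕ}

theorem invSqrt_transpose (A : Matrix (Fin m) (Fin m) ℝ) : (invSqrt A)ᵀ = invSqrt A := by
  have h : (CFC.sqrt A⁻¹).PosSemidef := Matrix.nonneg_iff_posSemidef.1 (CFC.sqrt_nonneg _)
  simpa [invSqrt, Matrix.IsHermitian, Matrix.conjTranspose_eq_transpose_of_trivial] using h.1

theorem invSqrt_mul_self {A : Matrix (Fin m) (Fin m) ℝ} (hA : A.PosSemidef) :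
    invSqrt A * invSqrt A = A⁻¹ :=
  CFC.sqrt_mul_sqrt_self _ hA.inv.nonneg

theorem invSqrt_of_not_isUnit {A : Matrix (Fin m) (Fin m) ℝ} (hA : ¬IsUnit A.det) :
    invSqrt A = 0 := by
  rw [invSqrt, Matrix.nonsing_inv_apply_not_isUnit A hA, CFC.sqrt_zero]

theorem isUnit_invSqrt_det {A : Matrix (Fin m) (Fin m) ℝ} (hA : A.PosDef) :
    IsUnit (invSqrt A).det := by
  have h1 : (invSqrt A).det * (invSqrt A).det = A⁻¹.det := by
    rw [← Matrix.det_mul, invSqrt_mul_self hA.posSemidef]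
  have h2 : A⁻¹.det ≠ 0 := hA.inv.det_pos.ne'
  rw [isUnit_iff_ne_zero]
  rintro h
  rw [h, mul_zero] at h1
  exact h2 h1.symm

theorem invSqrt_mul_mul_invSqrt {A : Matrix (Fin m) (Fin m) ℝ} (hA : A.PosDef) :
    invSqrt A * A * invSqrt A = 1 := by
  have hu := isUnit_invSqrt_det hA
  have hA' : IsUnit A.det := isUnit_iff_ne_zero.2 hA.det_pos.ne'
  have h1 : A * (invSqrt A * invSqrt A) = 1 := by
    rw [invSqrt_mul_self hA.posSemidef, Matrix.mul_nonsing_inv _ hA']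
  have h2 : (A * invSqrt A) * invSqrt A = 1 := by rw [Matrix.mul_assoc, h1]
  rw [Matrix.mul_assoc]
  exact mul_eq_one_comm.1 h2

/-- `Σ^{-1/2} α_x (α_xᵀ Σ⁻¹ α_x)^{-1/2}` as a function of `Σ`: the common form of `alpha` and
`alphaHat`. -/
def alphaOf {p r : ℕ} (A : Matrix (Fin p) (Fin p) ℝ) (αx : Matrix (Fin p) (Fin r) ℝ) :
    Matrix (Fin p) (Fin r) ℝ :=
  invSqrt A * αx * invSqrt (αxᵀ * A⁻¹ * αx)

section AlphaOf

variable {p r q : ℕ} {A : Matrix (Fin p) (Fin p) ℝ} {αx : Matrix (Fin p) (Fin r) ℝ}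

theorem mulVec_injective_of_rank (hαx : αx.rank = r) : Function.Injective αx.mulVec := by
  have h1 := LinearMap.finrank_range_add_finrank_ker αx.mulVecLin
  rw [← Matrix.rank, hαx, Module.finrank_fin_fun] at h1
  have h2 : LinearMap.ker αx.mulVecLin = ⊥ := Submodule.finrank_eq_zero.1 (by omega)
  exact LinearMap.ker_eq_bot.1 h2

theorem posDef_conj (hA : A.PosDef) (hαx : αx.rank = r) : (αxᵀ * A⁻¹ * αx).PosDef := by
  have := hA.inv.conjTranspose_mul_mul_same (mulVec_injective_of_rank hαx)
  rwa [Matrix.conjTranspose_eq_transpose_of_trivial] at this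

theorem posSemidef_conj (hA : A.PosSemidef) : (αxᵀ * A⁻¹ * αx).PosSemidef := by
  have := hA.inv.conjTranspose_mul_mul_same αx
  rwa [Matrix.conjTranspose_eq_transpose_of_trivial] at this

theorem alphaOf_transpose_mul_self (hA : A.PosDef) (hαx : αx.rank = r) :
    (alphaOf A αx)ᵀ * alphaOf A αx = 1 := by
  rw [alphaOf, Matrix.transpose_mul, Matrix.transpose_mul, invSqrt_transpose, invSqrt_transpose]
  rw [← invSqrt_mul_mul_invSqrt (posDef_conj hA hαx), ← invSqrt_mul_self hA.posSemidef]
  simp only [Matrix.mul_assoc]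

theorem posDef_of_posSemidef_of_isUnit (hA : A.PosSemidef) (hu : IsUnit A.det) : A.PosDef :=
  hA.posDef_iff_isUnit.2 ((Matrix.isUnit_iff_isUnit_det A).2 hu)

/-- `α αᵀ` is a projection; it is `0` when `Σ` is singular. -/
theorem alphaOf_mul_transpose_idem (hA : A.PosSemidef) (hαx : αx.rank = r) :
    alphaOf A αx * (alphaOf A αx)ᵀ * (alphaOf A αx * (alphaOf A αx)ᵀ) =
      alphaOf A αx * (alphaOf A αx)ᵀ := by
  by_cases hu : IsUnit A.det
  · rw [Matrix.mul_assoc, ← Matrix.mul_assoc _ (alphaOf A αx),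
      alphaOf_transpose_mul_self (posDef_of_posSemidef_of_isUnit hA hu) hαx, Matrix.one_mul]
  · simp [alphaOf, invSqrt_of_not_isUnit hu]

theorem alphaOf_transpose_mul_eq_zero_iff (hA : A.PosSemidef) (hαx : αx.rank = r)
    (B : Matrix (Fin p) (Fin q) ℝ) :
    (alphaOf A αx)ᵀ * B = 0 ↔ (invSqrt A * αx)ᵀ * B = 0 := by
  by_cases hu : IsUnit A.det
  · have hS := isUnit_invSqrt_det (posDef_conj (posDef_of_posSemidef_of_isUnit hA hu) hαx)
    rw [alphaOf, Matrix.transpose_mul, invSqrt_transpose, Matrix.mul_assoc]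
    refine ⟨fun h => ?_, fun h => by rw [h, Matrix.mul_zero]⟩
    have := congrArg (fun M => (invSqrt (αxᵀ * A⁻¹ * αx))⁻¹ * M) h
    simpa [Matrix.nonsing_inv_mul_cancel_left _ _ hS] using this
  · simp [alphaOf, invSqrt_of_not_isUnit hu]

theorem alphaOf_transpose_mul_invSqrt (hA : A.PosSemidef) :
    (alphaOf A αx)ᵀ * invSqrt A = invSqrt (αxᵀ * A⁻¹ * αx) * αxᵀ * A⁻¹ := by
  rw [alphaOf, Matrix.transpose_mul, Matrix.transpose_mul, invSqrt_transpose, invSqrt_transpose,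
    ← invSqrt_mul_self hA]
  simp only [Matrix.mul_assoc]

end AlphaOf

end InvSqrt

/-! ### The residual sums of squares -/

section Sample

variable {p h r d n : ℕ} (x : Fin n → Vec p) (y : Fin n → Fin h)

theorem mulV_apply {p q : ℕ} (A : Matrix (Fin q) (Fin p) ℝ) (v : Vec p) (i : Fin q) :
    mulV A v i = ∑ j, A i j * v j := by
  simp [mulV, Matrix.mulVec, dotProduct]

theorem mulV_eq {p q : ℕ} (A : Matrix (Fin q) (Fin p) ℝ) (v : Vec p) :
    mulV A v = Matrix.toEuclideanLin A v := by
  simp [mulV, Matrix.toLpLin_apply]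

theorem inner_mulV {p q : ℕ} (A : Matrix (Fin q) (Fin p) ℝ) (v : Vec p) (w : Vec q) :
    inner ℝ w (mulV A v) = inner ℝ (mulV Aᵀ w) v := by
  simp only [PiLp.inner_apply, mulV_apply, RCLike.inner_apply, conj_trivial,
    Matrix.transpose_apply, Finset.sum_mul, Finset.mul_sum]
  rw [Finset.sum_comm]
  exact Finset.sum_congr rfl fun j _ => Finset.sum_congr rfl fun i _ => by ring

theorem norm_mulV_of_orthonormal {p d : ℕ} {B : Matrix (Fin p) (Fin d) ℝ} (hB : Bᵀ * B = 1)
    (v : Vec d) : ‖mulV B v‖ ^ 2 = ‖v‖ ^ 2 := by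
  rw [← real_inner_self_eq_norm_sq, ← real_inner_self_eq_norm_sq, inner_mulV]
  congr 1
  rw [mulV, mulV, Matrix.mulVec_mulVec, hB, Matrix.one_mulVec]

theorem sum_sub_meanHat : ∑ i, (x i - meanHat x) = 0 := by
  rcases Nat.eq_zero_or_pos n with rfl | hn
  · simp
  · have : (n : ℝ) ≠ 0 := by positivity
    rw [Finset.sum_sub_distrib, Finset.sum_const, Finset.card_univ, Fintype.card_fin, meanHat,
      ← Nat.cast_smul_eq_nsmul ℝ, smul_smul, mul_inv_cancel₀ this, one_smul, sub_self]

theorem posSemidef_covHat : (covHat x).PosSemidef := by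
  refine Matrix.PosSemidef.smul (Matrix.posSemidef_sum _ fun i _ => ?_) (by positivity)
  simpa using Matrix.posSemidef_vecMulVec_self_star (WithLp.ofLp (x i - meanHat x))

theorem sum_zHat : ∑ i, zHat x i = 0 := by
  simp_rw [zHat, mulV_eq]
  rw [← map_sum, sum_sub_meanHat, map_zero]

theorem sliceCount_smul_zBar (k : Fin h) :
    (sliceCount y k : ℝ) • zBar x y k = ∑ i with y i = k, zHat x i := by
  rw [zBar]
  rcases Nat.eq_zero_or_pos (sliceCount y k) with h0 | h0
  · have : (Finset.univ.filter fun i => y i = k) = ∅ := Finset.card_eq_zero.1 h0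
    simp [this]
  · rw [smul_smul, mul_inv_cancel₀ (by positivity), one_smul]

theorem sum_sliceCount_smul_zBar : ∑ k, (sliceCount y k : ℝ) • zBar x y k = 0 := by
  simp_rw [sliceCount_smul_zBar]
  rw [Finset.sum_fiberwise, sum_zHat]

/-- The loss is minimized over `C` by the projected slice averages. -/
theorem loss_eq {m : ℕ} {B : Matrix (Fin p) (Fin m) ℝ} (hB : Bᵀ * B = 1) (C : Fin h → Vec m) :
    loss x y B C = ∑ i, ‖zHat x i‖ ^ 2 - n * frobSq (Bᵀ * zMat x y) +
      ∑ k, (sliceCount y k : ℝ) * ‖C k - mulV Bᵀ (zBar x y k)‖ ^ 2 := by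
  have hterm : ∀ i, ‖zHat x i - mulV B (C (y i))‖ ^ 2 =
      ‖zHat x i‖ ^ 2 + (‖C (y i)‖ ^ 2 - 2 * inner ℝ (mulV Bᵀ (zHat x i)) (C (y i))) := fun i => by
    rw [norm_sub_sq_real, norm_mulV_of_orthonormal hB, inner_mulV]
    ring
  have hslice : ∀ k, ∑ i with y i = k, (‖C (y i)‖ ^ 2 -
      2 * inner ℝ (mulV Bᵀ (zHat x i)) (C (y i))) =
      (sliceCount y k : ℝ) * ‖C k - mulV Bᵀ (zBar x y k)‖ ^ 2 -
        (sliceCount y k : ℝ) * ‖mulV Bᵀ (zBar x y k)‖ ^ 2 := fun k => by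
    have h1 : ∑ i with y i = k, (‖C (y i)‖ ^ 2 - 2 * inner ℝ (mulV Bᵀ (zHat x i)) (C (y i))) =
        ∑ i with y i = k, (‖C k‖ ^ 2 - 2 * inner ℝ (mulV Bᵀ (zHat x i)) (C k)) :=
      Finset.sum_congr rfl fun i hi => by rw [(Finset.mem_filter.1 hi).2]
    have h2 : ∑ i with y i = k, inner ℝ (mulV Bᵀ (zHat x i)) (C k) =
        (sliceCount y k : ℝ) * inner ℝ (mulV Bᵀ (zBar x y k)) (C k) := by
      rw [← sum_inner]
      simp_rw [mulV_eq]
      rw [← map_sum, ← sliceCount_smul_zBar, map_smul, real_inner_smul_left]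
    rw [h1, Finset.sum_sub_distrib, ← Finset.mul_sum, h2, Finset.sum_const, nsmul_eq_mul,
      norm_sub_sq_real, real_inner_comm]
    change (sliceCount y k : ℝ) * _ - _ = _
    ring
  have hfrob : (n : ℝ) * frobSq (Bᵀ * zMat x y) =
      ∑ k, (sliceCount y k : ℝ) * ‖mulV Bᵀ (zBar x y k)‖ ^ 2 := by
    rcases Nat.eq_zero_or_pos n with rfl | hn
    · simp [sliceCount]
    have hn' : (n : ℝ) ≠ 0 := by positivity
    rw [← frobSq_transpose, frobSq, Finset.mul_sum]
    refine Finset.sum_congr rfl fun k _ => ?_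
    have h1 : ∀ j, (Bᵀ * zMat x y)ᵀ k j = √(fHat y k) * mulV Bᵀ (zBar x y k) j := fun j => by
      rw [Matrix.transpose_apply, Matrix.mul_apply, mulV_apply, Finset.mul_sum]
      exact Finset.sum_congr rfl fun l _ => by simp only [zMat, Matrix.of_apply]; ring
    have h2 : 0 ≤ fHat y k := by unfold fHat; positivity
    simp_rw [h1, mul_pow, Real.sq_sqrt h2, ← Finset.mul_sum]
    rw [EuclideanSpace.real_norm_sq_eq, ← mul_assoc, fHat, mul_div_cancel₀ _ hn']
  rw [loss]
  simp_rw [hterm]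
  rw [Finset.sum_add_distrib, hfrob,
    ← Finset.sum_fiberwise Finset.univ y (fun i => ‖C (y i)‖ ^ 2 -
      2 * inner ℝ (mulV Bᵀ (zHat x i)) (C (y i)))]
  simp_rw [hslice]
  rw [Finset.sum_sub_distrib]
  ring

theorem sum_fHat_smul_mulV_zBar {m : ℕ} (B : Matrix (Fin p) (Fin m) ℝ) :
    ∑ k, fHat y k • mulV Bᵀ (zBar x y k) = 0 := by
  have h1 : ∀ k, fHat y k • mulV Bᵀ (zBar x y k) =
      (n : ℝ)⁻¹ • Matrix.toEuclideanLin Bᵀ ((sliceCount y k : ℝ) • zBar x y k) := fun k => by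
    rw [mulV_eq, map_smul, smul_smul, fHat, div_eq_inv_mul]
  simp_rw [h1]
  rw [← Finset.smul_sum, ← map_sum, sum_sliceCount_smul_zBar, map_zero, smul_zero]

/-- The constrained least squares minimum in terms of the best projection: here the constraint on
`B` is `A B = 0`, and `M` is the part of `ℤ_n` that matters under this constraint. -/
theorem sInf_loss_eq {a : ℕ} (A : Matrix (Fin a) (Fin p) ℝ) (hda : d + a ≤ p) (hdh : d ≤ h)
    (M : Matrix (Fin p) (Fin h) ℝ) (hAM : A * M = 0)
    (hM : ∀ B : Matrix (Fin p) (Fin d) ℝ, A * B = 0 → Bᵀ * zMat x y = Bᵀ * M) :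
    sInf {l | ∃ (B : Matrix (Fin p) (Fin d) ℝ) (C : Fin h → Vec d),
      Bᵀ * B = 1 ∧ ∑ k, fHat y k • C k = 0 ∧ A * B = 0 ∧ l = loss x y B C} =
      ∑ i, ‖zHat x i‖ ^ 2 - n * topEnergy d M := by
  refine IsLeast.csInf_eq ⟨?_, ?_⟩
  · obtain ⟨B, hB, hAB, hle⟩ := exists_topEnergy_le hdh A hda M hAM
    refine ⟨B, fun k => mulV Bᵀ (zBar x y k), hB, sum_fHat_smul_mulV_zBar x y B, hAB, ?_⟩
    rw [loss_eq x y hB, hM B hAB, hle.antisymm (frobSq_transpose_mul_le_topEnergy hdh M hB)]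
    simp
  · rintro l ⟨B, C, hB, -, hAB, rfl⟩
    rw [loss_eq x y hB, hM B hAB]
    have h1 := mul_le_mul_of_nonneg_left (frobSq_transpose_mul_le_topEnergy hdh M hB)
      (Nat.cast_nonneg (α := ℝ) n)
    have h2 : 0 ≤ ∑ k, (sliceCount y k : ℝ) * ‖C k - mulV Bᵀ (zBar x y k)‖ ^ 2 :=
      Finset.sum_nonneg fun _ _ => by positivity
    linarith

theorem rss_eq (hdp : d ≤ p) (hdh : d ≤ h) :
    rss x y d = ∑ i, ‖zHat x i‖ ^ 2 - n * topEnergy d (zMat x y) := by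
  rw [← sInf_loss_eq x y (0 : Matrix (Fin 0) (Fin p) ℝ) (by omega) hdh (zMat x y)
    (Matrix.zero_mul _) fun _ _ => rfl, rss]
  simp

theorem starProjection_colSpan_eq_zero_iff (A : Matrix (Fin p) (Fin r) ℝ) (v : Vec p) :
    (colSpan A).starProjection v = 0 ↔ ∀ i, ∑ j, A j i * v j = 0 := by
  rw [Submodule.starProjection_apply_eq_zero_iff]
  have h1 : v ∈ (colSpan A)ᗮ ↔ colSpan A ≤ (Submodule.span ℝ {v})ᗮ := by
    rw [Submodule.le_orthogonal_iff_le_orthogonal, Submodule.span_singleton_le_iff_mem]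
  rw [h1, colSpan, Submodule.span_le, Set.range_subset_iff]
  refine forall_congr' fun i => ?_
  rw [SetLike.mem_coe, Submodule.mem_orthogonal_singleton_iff_inner_right]
  simp [PiLp.inner_apply]

theorem hypSpaceHat_constraint_iff (αx : Matrix (Fin p) (Fin r) ℝ) (hαx : αx.rank = r)
    (B : Matrix (Fin p) (Fin d) ℝ) :
    (∀ j, (hypSpaceHat x αx).starProjection (WithLp.toLp 2 (B.col j)) = 0) ↔
      (alphaOf (covHat x) αx)ᵀ * B = 0 := by
  rw [alphaOf_transpose_mul_eq_zero_iff (posSemidef_covHat x) hαx, hypSpaceHat]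
  simp_rw [starProjection_colSpan_eq_zero_iff]
  rw [← Matrix.ext_iff, forall_comm]
  simp [Matrix.mul_apply, -Matrix.transpose_mul]

theorem rssCoord_eq (hdp : d + r ≤ p) (hdh : d ≤ h) (αx : Matrix (Fin p) (Fin r) ℝ)
    (hαx : αx.rank = r) :
    rssCoord x y αx d = ∑ i, ‖zHat x i‖ ^ 2 - n * topEnergy d
      ((1 - alphaOf (covHat x) αx * (alphaOf (covHat x) αx)ᵀ) * zMat x y) := by
  set α := alphaOf (covHat x) αx with hα
  have hzero : αᵀ * (1 - α * αᵀ) = 0 := by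
    by_cases hu : IsUnit (covHat x).det
    · rw [Matrix.mul_sub, ← Matrix.mul_assoc, hα, alphaOf_transpose_mul_self
        (posDef_of_posSemidef_of_isUnit (posSemidef_covHat x) hu) hαx]
      simp
    · simp [hα, alphaOf, invSqrt_of_not_isUnit hu]
  rw [← sInf_loss_eq x y αᵀ hdp hdh, rssCoord]
  · simp_rw [hypSpaceHat_constraint_iff x αx hαx, ← hα]
  · rw [← Matrix.mul_assoc, hzero, Matrix.zero_mul]
  · intro B hB
    have hB' : Bᵀ * α = 0 := by
      rw [← Matrix.transpose_transpose (Bᵀ * α), Matrix.transpose_mul, Matrix.transpose_transpose,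
        hB, Matrix.transpose_zero]
    rw [← Matrix.mul_assoc, Matrix.mul_sub, ← Matrix.mul_assoc, hB']
    simp

/-- The statistic is the drop in captured energy caused by the coordinate constraint. -/
theorem condCoordStat_eq (hdp : d + r ≤ p) (hdh : d ≤ h) (αx : Matrix (Fin p) (Fin r) ℝ)
    (hαx : αx.rank = r) :
    condCoordStat x y αx d = n * (topEnergy d (zMat x y) - topEnergy d
      ((1 - alphaOf (covHat x) αx * (alphaOf (covHat x) αx)ᵀ) * zMat x y)) := by
  rw [condCoordStat, rss_eq x y (by omega) hdh, rssCoord_eq x y hdp hdh αx hαx]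
  ring

end Sample

/-! ### Measurability and continuity of matrix functions -/

section MatrixMeasurable

/-- The product `σ`-algebra on real matrices. -/
@[reducible] def matrixMeasurableSpace (a b : ℕ) : MeasurableSpace (Matrix (Fin a) (Fin b) ℝ) :=
  MeasurableSpace.pi

attribute [local instance] matrixMeasurableSpace

theorem matrix_borelSpace (a b : ℕ) : BorelSpace (Matrix (Fin a) (Fin b) ℝ) :=
  inferInstanceAs (BorelSpace (Fin a → Fin b → ℝ))

attribute [local instance] matrix_borelSpace

variable {a b c m : ℕ}

theorem measurable_inv : Measurable fun A : Matrix (Fin m) (Fin m) ℝ => A⁻¹ := by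
  simp_rw [Matrix.inv_def, Ring.inverse_eq_inv']
  have h1 : Measurable fun A : Matrix (Fin m) (Fin m) ℝ => A.det :=
    (by fun_prop : Continuous fun A : Matrix (Fin m) (Fin m) ℝ => A.det).measurable
  refine measurable_pi_lambda _ fun i => measurable_pi_lambda _ fun j => ?_
  have h2 : Continuous fun A : Matrix (Fin m) (Fin m) ℝ => A.adjugate i j :=
    (by fun_prop : Continuous fun A : Matrix (Fin m) (Fin m) ℝ => A.adjugate).matrix_elem i j
  exact h1.inv.mul h2.measurable

section
open scoped Matrix.Norms.L2Operator

theorem continuousOn_cfcSqrt (m : ℕ) :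
    ContinuousOn (CFC.sqrt : Matrix (Fin m) (Fin m) ℝ → Matrix (Fin m) (Fin m) ℝ) {A | 0 ≤ A} :=
  CFC.continuousOn_sqrt

end

theorem isClosed_posSemidef : IsClosed {A : Matrix (Fin m) (Fin m) ℝ | 0 ≤ A} := by
  have h : {A : Matrix (Fin m) (Fin m) ℝ | 0 ≤ A} =
      {A | Aᴴ = A} ∩ ⋂ v : Fin m → ℝ, {A | 0 ≤ star v ⬝ᵥ (A *ᵥ v)} := by
    ext A
    simp only [Set.mem_ofPred_eq, Set.mem_inter_iff, Set.mem_iInter]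
    rw [Matrix.nonneg_iff_posSemidef, Matrix.posSemidef_iff_dotProduct_mulVec]
    rfl
  rw [h]
  refine IsClosed.inter ?_ (isClosed_iInter fun v => ?_)
  · exact isClosed_eq (f := fun A : Matrix (Fin m) (Fin m) ℝ => Aᴴ) (by fun_prop) continuous_id
  · exact isClosed_le continuous_const
      (f := fun _ => (0 : ℝ)) (g := fun A : Matrix (Fin m) (Fin m) ℝ => star v ⬝ᵥ (A *ᵥ v))
      (by fun_prop)

theorem measurable_cfcSqrt :
    Measurable (CFC.sqrt : Matrix (Fin m) (Fin m) ℝ → Matrix (Fin m) (Fin m) ℝ) := by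
  classical
  -- outside the cone of positive semidefinite matrices the square root is `0` by convention
  have h : (CFC.sqrt : Matrix (Fin m) (Fin m) ℝ → Matrix (Fin m) (Fin m) ℝ) =
      Set.piecewise {A | 0 ≤ A} CFC.sqrt (fun _ => 0) := by
    ext1 A
    by_cases hA : 0 ≤ A
    · simp [Set.piecewise, hA]
    · rw [Set.piecewise_eq_of_notMem _ _ _ (by simpa using hA), CFC.sqrt,
        cfcₙ_apply_of_not_predicate A hA]
  rw [h]
  exact (continuousOn_cfcSqrt m).measurable_piecewise continuousOn_const
    isClosed_posSemidef.measurableSet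

theorem measurable_invSqrt :
    Measurable (invSqrt : Matrix (Fin m) (Fin m) ℝ → Matrix (Fin m) (Fin m) ℝ) :=
  measurable_cfcSqrt.comp measurable_inv

section AE

variable {Ω : Type*} [MeasurableSpace Ω] {P : Measure Ω}

theorem aemeasurable_matrix_mul {f : Ω → Matrix (Fin a) (Fin b) ℝ}
    {g : Ω → Matrix (Fin b) (Fin c) ℝ} (hf : AEMeasurable f P) (hg : AEMeasurable g P) :
    AEMeasurable (fun ω => f ω * g ω) P := by
  refine aemeasurable_pi_lambda _ fun i => aemeasurable_pi_lambda _ fun j => ?_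
  simp only [Matrix.mul_apply]
  refine Finset.aemeasurable_fun_sum _ fun k _ => ?_
  exact (aemeasurable_pi_iff.1 (aemeasurable_pi_iff.1 hf i) k).mul
    (aemeasurable_pi_iff.1 (aemeasurable_pi_iff.1 hg k) j)

theorem aemeasurable_matrix_transpose {f : Ω → Matrix (Fin a) (Fin b) ℝ}
    (hf : AEMeasurable f P) : AEMeasurable (fun ω => (f ω)ᵀ) P :=
  aemeasurable_pi_lambda _ fun i => aemeasurable_pi_lambda _ fun j =>
    aemeasurable_pi_iff.1 (aemeasurable_pi_iff.1 hf j) i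

theorem aemeasurable_alphaOf {p r : ℕ} {f : Ω → Matrix (Fin p) (Fin p) ℝ}
    (hf : AEMeasurable f P) (αx : Matrix (Fin p) (Fin r) ℝ) :
    AEMeasurable (fun ω => alphaOf (f ω) αx) P :=
  aemeasurable_matrix_mul (aemeasurable_matrix_mul (measurable_invSqrt.comp_aemeasurable hf)
    aemeasurable_const) (measurable_invSqrt.comp_aemeasurable
      (aemeasurable_matrix_mul (aemeasurable_matrix_mul aemeasurable_const
        (measurable_inv.comp_aemeasurable hf)) aemeasurable_const))

end AE

section Limits

variable {ι : Type*} {l : Filter ι}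

theorem tendsto_inv_matrix {f : ι → Matrix (Fin m) (Fin m) ℝ} {A : Matrix (Fin m) (Fin m) ℝ}
    (hA : A.PosDef) (hf : Tendsto f l (𝓝 A)) : Tendsto (fun i => (f i)⁻¹) l (𝓝 A⁻¹) := by
  refine Tendsto.comp (continuousAt_matrix_inv A ?_) hf
  rw [Ring.inverse_eq_inv']
  exact continuousAt_inv₀ hA.det_pos.ne'

theorem tendsto_invSqrt {f : ι → Matrix (Fin m) (Fin m) ℝ} {A : Matrix (Fin m) (Fin m) ℝ}
    (hA : A.PosDef) (hf0 : ∀ i, (f i).PosSemidef) (hf : Tendsto f l (𝓝 A)) :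
    Tendsto (fun i => invSqrt (f i)) l (𝓝 (invSqrt A)) := by
  have h1 := continuousOn_cfcSqrt m A⁻¹ hA.inv.posSemidef.nonneg
  exact h1.tendsto.comp (tendsto_nhdsWithin_iff.2
    ⟨tendsto_inv_matrix hA hf, Eventually.of_forall fun i => (hf0 i).inv.nonneg⟩)

theorem tendsto_matrix_mul {f : ι → Matrix (Fin a) (Fin b) ℝ} {g : ι → Matrix (Fin b) (Fin c) ℝ}
    {A : Matrix (Fin a) (Fin b) ℝ} {B : Matrix (Fin b) (Fin c) ℝ}
    (hf : Tendsto f l (𝓝 A)) (hg : Tendsto g l (𝓝 B)) :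
    Tendsto (fun i => f i * g i) l (𝓝 (A * B)) := by
  have hc : Continuous fun x : Matrix (Fin a) (Fin b) ℝ × Matrix (Fin b) (Fin c) ℝ =>
    x.1 * x.2 := by fun_prop
  exact (hc.tendsto (A, B)).comp (hf.prodMk_nhds hg)

theorem tendsto_matrix_iff {f : ι → Matrix (Fin a) (Fin b) ℝ} {A : Matrix (Fin a) (Fin b) ℝ} :
    Tendsto f l (𝓝 A) ↔ ∀ i j, Tendsto (fun k => f k i j) l (𝓝 (A i j)) :=
  tendsto_pi_nhds.trans (forall_congr' fun _ => tendsto_pi_nhds)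

variable {p r : ℕ} {αx : Matrix (Fin p) (Fin r) ℝ}

theorem tendsto_invSqrt_conj (hαx : αx.rank = r) {f : ι → Matrix (Fin p) (Fin p) ℝ}
    {A : Matrix (Fin p) (Fin p) ℝ} (hA : A.PosDef) (hf0 : ∀ i, (f i).PosSemidef)
    (hf : Tendsto f l (𝓝 A)) :
    Tendsto (fun i => invSqrt (αxᵀ * (f i)⁻¹ * αx)) l (𝓝 (invSqrt (αxᵀ * A⁻¹ * αx))) :=
  tendsto_invSqrt (posDef_conj hA hαx) (fun i => posSemidef_conj (hf0 i))
    (tendsto_matrix_mul (tendsto_matrix_mul tendsto_const_nhds (tendsto_inv_matrix hA hf))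
      tendsto_const_nhds)

theorem tendsto_alphaOf (hαx : αx.rank = r) {f : ι → Matrix (Fin p) (Fin p) ℝ}
    {A : Matrix (Fin p) (Fin p) ℝ} (hA : A.PosDef) (hf0 : ∀ i, (f i).PosSemidef)
    (hf : Tendsto f l (𝓝 A)) :
    Tendsto (fun i => alphaOf (f i) αx) l (𝓝 (alphaOf A αx)) :=
  tendsto_matrix_mul (tendsto_matrix_mul (tendsto_invSqrt hA hf0 hf) tendsto_const_nhds)
    (tendsto_invSqrt_conj hαx hA hf0 hf)

end Limits

end MatrixMeasurable

attribute [local instance] matrixMeasurableSpace matrix_borelSpace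

/-! ### Sample moments -/

section Moments

variable {p h r n : ℕ}

/-- The average of `n` real numbers. -/
def avg {n : ℕ} (u : Fin n → ℝ) : ℝ := (n : ℝ)⁻¹ * ∑ i, u i

theorem avg_add (u v : Fin n → ℝ) : avg (fun i => u i + v i) = avg u + avg v := by
  simp [avg, Finset.sum_add_distrib, mul_add]

theorem avg_sub (u v : Fin n → ℝ) : avg (fun i => u i - v i) = avg u - avg v := by
  simp [avg, Finset.sum_sub_distrib, mul_sub]

theorem avg_const_mul (c : ℝ) (u : Fin n → ℝ) : avg (fun i => c * u i) = c * avg u := by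
  simp only [avg, ← Finset.mul_sum]
  ring

theorem avg_sum {ι : Type*} (s : Finset ι) (u : ι → Fin n → ℝ) :
    avg (fun i => ∑ j ∈ s, u j i) = ∑ j ∈ s, avg (u j) := by
  simp only [avg, ← Finset.mul_sum]
  rw [Finset.sum_comm]

/-- Centered numbers average to `0`, also in the empty case. -/
theorem avg_sub_avg (u : Fin n → ℝ) : avg (fun i => u i - avg u) = 0 := by
  rcases Nat.eq_zero_or_pos n with rfl | hn
  · simp [avg]
  · have : (n : ℝ) ≠ 0 := by positivity
    rw [avg_sub u fun _ => avg u]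
    simp [avg, this]

theorem avg_centered_mul (u v : Fin n → ℝ) :
    avg (fun i => (u i - avg u) * v i) = avg (fun i => u i * v i) - avg u * avg v := by
  simp_rw [sub_mul]
  rw [avg_sub (fun i => u i * v i), avg_const_mul]

theorem avg_centered_mul_sub_const (u v : Fin n → ℝ) (c : ℝ) :
    avg (fun i => (u i - avg u) * (v i - c)) = avg (fun i => (u i - avg u) * v i) := by
  have h1 : ∀ i, (u i - avg u) * (v i - c) = (u i - avg u) * v i - c * (u i - avg u) :=
    fun i => by ring
  simp_rw [h1]
  rw [avg_sub (fun i => (u i - avg u) * v i), avg_const_mul, avg_sub_avg]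
  ring

variable (x : Fin n → Vec p) (y : Fin n → Fin h)

/-- The `p × h` matrix of sample covariances between the predictors and the slice indicators. -/
def crossHat : Matrix (Fin p) (Fin h) ℝ :=
  Matrix.of fun j k => avg fun i => (x i j - avg fun i => x i j) * J k (x i, y i)

/-- The diagonal matrix of the inverse square roots of the slice fractions. -/
def scaleHat : Matrix (Fin h) (Fin h) ℝ := Matrix.diagonal fun k => (√(fHat y k))⁻¹

theorem meanHat_apply (j : Fin p) : meanHat x j = avg fun i => x i j := by
  simp [meanHat, avg]

theorem covHat_apply (j l : Fin p) : covHat x j l =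
    avg fun i => (x i j - avg fun i => x i j) * x i l := by
  rw [← avg_centered_mul_sub_const (fun i => x i j) (fun i => x i l) (avg fun i => x i l)]
  simp [covHat, avg, Matrix.sum_apply, Matrix.vecMulVec_apply, meanHat_apply]

theorem fHat_eq_avg (k : Fin h) : fHat y k = avg fun i => J k (x i, y i) := by
  simp [fHat, avg, sliceCount, J, div_eq_inv_mul]

theorem zMat_eq : zMat x y = invSqrt (covHat x) * crossHat x y * scaleHat y := by
  ext j k
  rw [scaleHat, Matrix.mul_diagonal, zMat, Matrix.of_apply, zBar]
  have h1 : ∑ i with y i = k, zHat x i j =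
      n * (invSqrt (covHat x) * crossHat x y) j k := by
    rcases Nat.eq_zero_or_pos n with rfl | hn
    · simp
    have hn' : (n : ℝ) ≠ 0 := by positivity
    simp_rw [zHat, mulV_apply]
    rw [Finset.sum_comm, Matrix.mul_apply, Finset.mul_sum]
    refine Finset.sum_congr rfl fun l _ => ?_
    rw [← Finset.mul_sum, Finset.sum_filter, crossHat, Matrix.of_apply]
    conv_rhs => rw [avg]
    rw [mul_left_comm, mul_inv_cancel_left₀ hn']
    congr 1
    refine Finset.sum_congr rfl fun i _ => ?_
    simp [J, meanHat_apply]
  have h2 : (((sliceCount y k : ℝ)⁻¹ • ∑ i with y i = k, zHat x i : Vec p)) j =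
      (sliceCount y k : ℝ)⁻¹ * ∑ i with y i = k, zHat x i j := by simp
  rw [h2, h1]
  rcases Nat.eq_zero_or_pos n with rfl | hn
  · simp [fHat]
  have hn' : (n : ℝ) ≠ 0 := by positivity
  rcases Nat.eq_zero_or_pos (sliceCount y k) with h0 | h0
  · simp [fHat, h0]
  have hc : (0 : ℝ) < sliceCount y k := by positivity
  have hf : 0 < fHat y k := by unfold fHat; positivity
  have h3 : √(fHat y k) * √(fHat y k) = (sliceCount y k : ℝ) / n := Real.mul_self_sqrt hf.le
  have h4 : √(fHat y k) ≠ 0 := (Real.sqrt_pos.2 hf).ne'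
  have hc' := hc.ne'
  have h5 : √(fHat y k) * ((sliceCount y k : ℝ)⁻¹ * n) = (√(fHat y k))⁻¹ := by
    refine eq_inv_of_mul_eq_one_left ?_
    rw [mul_right_comm, h3]
    field_simp
  rw [← h5]
  ring

theorem alphaOf_transpose_mul_zMat (αx : Matrix (Fin p) (Fin r) ℝ) :
    (alphaOf (covHat x) αx)ᵀ * zMat x y =
      invSqrt (αxᵀ * (covHat x)⁻¹ * αx) * αxᵀ * (covHat x)⁻¹ * crossHat x y * scaleHat y := by
  rw [zMat_eq, ← Matrix.mul_assoc, ← Matrix.mul_assoc,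
    alphaOf_transpose_mul_invSqrt (posSemidef_covHat x)]

end Moments

/-! ### Population moments -/

section PopulationMoments

variable {p h r d : ℕ} (ν : Measure (Vec p × Fin h)) [IsProbabilityMeasure ν]

/-- The `p × h` matrix of covariances between the predictors and the slice indicators. -/
def crossPop : Matrix (Fin p) (Fin h) ℝ :=
  Matrix.of fun j k => cov[fun w => w.1 j, J k; ν]

/-- `β`, with columns `β_y`. -/
def betaMat : Matrix (Fin p) (Fin h) ℝ := (covX ν)⁻¹ * crossPop ν

/-- The diagonal matrix of the inverse square roots of the slice probabilities. -/
def scalePop : Matrix (Fin h) (Fin h) ℝ := Matrix.diagonal fun k => (g ν k)⁻¹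

variable {ν}

theorem measurable_J (k : Fin h) : Measurable (J k : Vec p × Fin h → ℝ) := by
  have : Measurable fun y : Fin h => if y = k then (1 : ℝ) else 0 := measurable_of_countable _
  exact this.comp measurable_snd

theorem measurableSet_slice (k : Fin h) : MeasurableSet (slice k : Set (Vec p × Fin h)) :=
  measurable_snd (measurableSet_singleton k)

theorem J_eq_indicator (k : Fin h) :
    (J k : Vec p × Fin h → ℝ) = (slice k).indicator fun _ => 1 := by
  ext w
  simp [J, slice, Set.indicator_apply]

theorem memLp_J (k : Fin h) (q : ENNReal) : MemLp (J k) q ν := by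
  refine MemLp.of_bound (measurable_J k).aestronglyMeasurable 1 (ae_of_all _ fun w => ?_)
  unfold J
  split_ifs <;> simp

omit [IsProbabilityMeasure ν] in
theorem integral_J (k : Fin h) : ∫ w, J k w ∂ν = sliceProb ν k := by
  rw [J_eq_indicator, integral_indicator_const _ (measurableSet_slice k)]
  simp [sliceProb]

omit [IsProbabilityMeasure ν] in
theorem memLp_coord {q : ENNReal} (hX : MemLp (fun w : Vec p × Fin h => w.1) q ν) (j : Fin p) :
    MemLp (fun w : Vec p × Fin h => w.1 j) q ν :=
  hX.continuousLinearMap_comp (EuclideanSpace.proj j : Vec p →L[ℝ] ℝ)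

theorem measurable_coord (j : Fin p) : Measurable fun w : Vec p × Fin h => w.1 j := by
  fun_prop

theorem meanX_apply {q : ENNReal} (hq : 1 ≤ q)
    (hX : MemLp (fun w : Vec p × Fin h => w.1) q ν) (j : Fin p) :
    meanX ν j = ∫ w, w.1 j ∂ν :=
  ((EuclideanSpace.proj j : Vec p →L[ℝ] ℝ).integral_comp_comm (hX.integrable hq)).symm

variable (hX : MemLp (fun w : Vec p × Fin h => w.1) 4 ν)

include hX

theorem memLp_centered (j : Fin p) : MemLp (fun w : Vec p × Fin h => w.1 j - meanX ν j) 4 ν :=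
  (memLp_coord hX j).sub (memLp_const _)

theorem integral_centered (j : Fin p) : ∫ w, (w.1 j - meanX ν j) ∂ν = 0 := by
  rw [integral_sub ((memLp_coord hX j).integrable (by norm_num)) (integrable_const _),
    meanX_apply (by norm_num) hX]
  simp

theorem integrable_centered_mul {f : Vec p × Fin h → ℝ} (hf : MemLp f 4 ν) (j : Fin p) :
    Integrable (fun w => (w.1 j - meanX ν j) * f w) ν :=
  ((memLp_centered hX j).mono_exponent (by norm_num : (2 : ENNReal) ≤ 4)).integrable_mul
    (hf.mono_exponent (by norm_num : (2 : ENNReal) ≤ 4))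

theorem integral_centered_mul {f : Vec p × Fin h → ℝ} (hf : MemLp f 4 ν) (j : Fin p) :
    ∫ w, (w.1 j - meanX ν j) * f w ∂ν = cov[fun w => w.1 j, f; ν] := by
  rw [covariance, ← meanX_apply (by norm_num) hX j]
  simp_rw [mul_sub]
  rw [integral_sub (integrable_centered_mul hX hf j)
    (((memLp_centered hX j).integrable (by norm_num)).mul_const _), integral_mul_const,
    integral_centered hX]
  simp

theorem setIntegral_slice_centered (j : Fin p) (k : Fin h) :
    ∫ w in slice k, (w.1 j - meanX ν j) ∂ν = crossPop ν j k := by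
  rw [crossPop, Matrix.of_apply, ← integral_centered_mul hX (memLp_J k 4),
    ← integral_indicator (measurableSet_slice k), J_eq_indicator]
  refine integral_congr_ae (ae_of_all _ fun w => ?_)
  by_cases hw : w ∈ slice k <;> simp [hw]

theorem condMeanZ_apply (j : Fin p) (k : Fin h) :
    condMeanZ ν k j = (sliceProb ν k)⁻¹ * (invSqrt (covX ν) * crossPop ν) j k := by
  have hint : Integrable (fun w : Vec p × Fin h => w.1 - meanX ν) ν :=
    (hX.integrable (by norm_num)).sub (integrable_const _)
  have hZ : Integrable (stdZ ν) ν := by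
    have : stdZ ν = fun w => (Matrix.toEuclideanLin (invSqrt (covX ν))).toContinuousLinearMap
        (w.1 - meanX ν) := by
      ext1 w
      rw [stdZ, mulV_eq]
      rfl
    rw [this]
    exact ContinuousLinearMap.integrable_comp _ hint
  have hZk : Integrable (stdZ ν) (ν[|slice k]) := by
    rw [ProbabilityTheory.cond]
    by_cases h0 : ν (slice k) = 0
    · rw [Measure.restrict_eq_zero.2 h0, smul_zero]
      exact integrable_zero_measure
    · exact hZ.restrict.smul_measure (ENNReal.inv_ne_top.2 h0)
  have h1 : condMeanZ ν k j = ∫ w, stdZ ν w j ∂(ν[|slice k]) :=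
    ((EuclideanSpace.proj j : Vec p →L[ℝ] ℝ).integral_comp_comm hZk).symm
  rw [h1, ProbabilityTheory.cond, integral_smul_measure, ENNReal.toReal_inv, smul_eq_mul,
    Matrix.mul_apply]
  congr 1
  simp_rw [stdZ, mulV_apply]
  rw [integral_finsetSum]
  · refine Finset.sum_congr rfl fun l _ => ?_
    rw [integral_const_mul, ← setIntegral_slice_centered hX]
    rfl
  · intro l _
    exact (((memLp_centered hX l).integrable (by norm_num)).restrict).const_mul _

/-- `μ = Σ^{-1/2} Cov(X, J) D_g⁻¹`. -/
theorem muMat_eq : muMat ν = invSqrt (covX ν) * crossPop ν * scalePop ν := by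
  ext j k
  rw [scalePop, Matrix.mul_diagonal, muMat, Matrix.of_apply, condMeanZ_apply hX, ← mul_assoc,
    mul_comm]
  congr 1
  have h0 : 0 ≤ sliceProb ν k := measureReal_nonneg
  rw [g, ← div_eq_mul_inv, Real.sqrt_div_self]

theorem covX_apply (j l : Fin p) :
    covX ν j l = ∫ w, (w.1 j - meanX ν j) * (w.1 l - meanX ν l) ∂ν := by
  rw [covX, Matrix.of_apply, covariance, ← meanX_apply (by norm_num) hX j,
    ← meanX_apply (by norm_num) hX l]

omit hX

omit [IsProbabilityMeasure ν] in
theorem resid_eq (w : Vec p × Fin h) (k : Fin h) :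
    resid ν w k = J k w - sliceProb ν k - ∑ l, betaMat ν l k * (w.1 l - meanX ν l) := by
  rfl

omit [IsProbabilityMeasure ν] in
theorem measurable_resid (k : Fin h) : Measurable fun w => resid ν w k := by
  simp_rw [resid_eq]
  exact ((measurable_J k).sub_const _).sub (Finset.measurable_sum _ fun l _ =>
    ((measurable_coord l).sub_const _).const_mul _)

include hX

theorem memLp_resid (k : Fin h) : MemLp (fun w => resid ν w k) 4 ν := by
  simp_rw [resid_eq]
  exact ((memLp_J k 4).sub (memLp_const _)).sub
    (memLp_finsetSum _ fun l _ => (memLp_centered hX l).const_mul _)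

theorem integral_resid (k : Fin h) : ∫ w, resid ν w k ∂ν = 0 := by
  simp_rw [resid_eq]
  have hl : ∀ l, Integrable (fun w : Vec p × Fin h => betaMat ν l k * (w.1 l - meanX ν l)) ν :=
    fun l => ((memLp_centered hX l).integrable (by norm_num)).const_mul _
  have hJ : Integrable (J k : Vec p × Fin h → ℝ) ν := (memLp_J k 4).integrable (by norm_num)
  have hJ' : Integrable (fun w : Vec p × Fin h => J k w - sliceProb ν k) ν :=
    hJ.sub (integrable_const _)
  rw [integral_sub hJ' (integrable_finsetSum _ fun l _ => hl l),
    integral_sub hJ (integrable_const _), integral_J, integral_finsetSum _ fun l _ => hl l]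
  simp [integral_const_mul, integral_centered hX]

/-- The residuals are uncorrelated with the predictors. -/
theorem integral_centered_mul_resid (hcov : (covX ν).PosDef) (j : Fin p) (k : Fin h) :
    ∫ w, (w.1 j - meanX ν j) * resid ν w k ∂ν = 0 := by
  have hl : ∀ l, Integrable (fun w : Vec p × Fin h =>
      betaMat ν l k * ((w.1 j - meanX ν j) * (w.1 l - meanX ν l))) ν :=
    fun l => (integrable_centered_mul hX (memLp_centered hX l) j).const_mul _
  have hc : Integrable (fun w : Vec p × Fin h => (w.1 j - meanX ν j) * sliceProb ν k) ν :=
    ((memLp_centered hX j).integrable (by norm_num)).mul_const _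
  have hJ := integrable_centered_mul hX (memLp_J k 4) j
  have h1 : ∀ w : Vec p × Fin h, (w.1 j - meanX ν j) * resid ν w k =
      (w.1 j - meanX ν j) * J k w - (w.1 j - meanX ν j) * sliceProb ν k -
        ∑ l, betaMat ν l k * ((w.1 j - meanX ν j) * (w.1 l - meanX ν l)) := fun w => by
    rw [resid_eq, mul_sub, mul_sub, Finset.mul_sum]
    congr 1
    exact Finset.sum_congr rfl fun l _ => by ring
  simp_rw [h1]
  have hJ' : Integrable (fun w : Vec p × Fin h => (w.1 j - meanX ν j) * J k w -
      (w.1 j - meanX ν j) * sliceProb ν k) ν := hJ.sub hc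
  rw [integral_sub hJ' (integrable_finsetSum _ fun l _ => hl l), integral_sub hJ hc,
    integral_finsetSum _ fun l _ => hl l, integral_mul_const, integral_centered hX,
    integral_centered_mul hX (memLp_J k 4)]
  simp_rw [integral_const_mul, ← covX_apply hX]
  have h2 : (covX ν * betaMat ν) j k = crossPop ν j k := by
    rw [betaMat, ← Matrix.mul_assoc,
      Matrix.mul_nonsing_inv _ (isUnit_iff_ne_zero.2 hcov.det_pos.ne'), Matrix.one_mul]
  rw [Matrix.mul_apply] at h2
  rw [show cov[fun w => w.1 j, J k; ν] = crossPop ν j k from rfl, ← h2, zero_mul, sub_zero,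
    sub_eq_zero]
  exact Finset.sum_congr rfl fun l _ => mul_comm _ _

omit hX

variable {αx : Matrix (Fin p) (Fin r) ℝ} {S : Submodule ℝ (Vec p)}

omit [IsProbabilityMeasure ν] in
theorem sum_alpha_mul_eq_zero (hcoord : CoordinateHypothesis ν αx S) {v : Vec p} (hv : v ∈ S)
    (i : Fin r) : ∑ j, alpha ν αx j i * v j = 0 := by
  have h1 : (hypSpace ν αx).starProjection v ∈
      S.map ((hypSpace ν αx).starProjection : Vec p →ₗ[ℝ] Vec p) := ⟨v, hv, rfl⟩
  rw [hcoord, Submodule.mem_bot] at h1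
  exact (starProjection_colSpan_eq_zero_iff _ v).1 h1 i

omit [IsProbabilityMeasure ν] in
theorem alpha_transpose_mul_muMat (hcoverage : CoverageCondition ν S)
    (hcoord : CoordinateHypothesis ν αx S) : (alpha ν αx)ᵀ * muMat ν = 0 := by
  ext i k
  have h1 : condMeanZ ν k ∈ S := hcoverage ▸ Submodule.subset_span ⟨k, rfl⟩
  have h2 := sum_alpha_mul_eq_zero hcoord h1 i
  rw [Matrix.mul_apply]
  simp only [Matrix.transpose_apply, muMat, Matrix.of_apply, Matrix.zero_apply]
  rw [← mul_zero (g ν k), ← h2, Finset.mul_sum]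
  exact Finset.sum_congr rfl fun j _ => by ring

omit [IsProbabilityMeasure ν] in
theorem finrank_add_le (hcov : (covX ν).PosDef) (hαx : αx.rank = r)
    (hcoord : CoordinateHypothesis ν αx S) : Module.finrank ℝ S + r ≤ p := by
  let f : Vec p →ₗ[ℝ] Vec r := Matrix.toEuclideanLin (alpha ν αx)ᵀ
  have hS : S ≤ LinearMap.ker f := fun v hv => by
    rw [LinearMap.mem_ker]
    ext i
    have := sum_alpha_mul_eq_zero hcoord hv i
    rw [← mulV_eq, mulV_apply]
    simpa using this
  have hf : Function.Surjective f := fun u => by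
    refine ⟨mulV (alpha ν αx) u, ?_⟩
    rw [← mulV_eq, mulV, mulV, Matrix.mulVec_mulVec]
    have : (alpha ν αx)ᵀ * alpha ν αx = 1 := alphaOf_transpose_mul_self hcov hαx
    rw [this, Matrix.one_mulVec]
  have h1 := LinearMap.finrank_range_add_finrank_ker f
  rw [LinearMap.range_eq_top.2 hf, finrank_top, finrank_euclideanSpace_fin,
    finrank_euclideanSpace_fin] at h1
  have h2 := Submodule.finrank_mono hS
  omega

include hX

/-- Under the coordinate hypothesis the rows of `α_xᵀ` annihilate the regression coefficients. -/
theorem transpose_mul_betaMat (hcov : (covX ν).PosDef) (hslices : ∀ k, 0 < sliceProb ν k)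
    (hαx : αx.rank = r) (hcoverage : CoverageCondition ν S)
    (hcoord : CoordinateHypothesis ν αx S) : αxᵀ * betaMat ν = 0 := by
  have h1 := alpha_transpose_mul_muMat hcoverage hcoord
  rw [muMat_eq hX, ← Matrix.mul_assoc, ← Matrix.mul_assoc,
    show alpha ν αx = alphaOf (covX ν) αx from rfl,
    alphaOf_transpose_mul_invSqrt hcov.posSemidef] at h1
  have h2 : scalePop ν * Dg ν = 1 := by
    rw [scalePop, Dg, Matrix.diagonal_mul_diagonal, ← Matrix.diagonal_one]
    congr 1
    ext k
    exact inv_mul_cancel₀ (Real.sqrt_pos.2 (hslices k)).ne'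
  have h3 := congrArg (fun M => (invSqrt (αxᵀ * (covX ν)⁻¹ * αx))⁻¹ * (M * Dg ν)) h1
  simp only [Matrix.mul_assoc, h2, Matrix.mul_one, Matrix.zero_mul, Matrix.mul_zero] at h3
  rwa [Matrix.nonsing_inv_mul_cancel_left _ _
    (isUnit_invSqrt_det (by simpa only [Matrix.mul_assoc] using posDef_conj hcov hαx))] at h3

end PopulationMoments

/-! ### The singular value decomposition -/

section SVD

variable {p h d : ℕ} {M : Matrix (Fin p) (Fin h) ℝ} {Γ₁ : Matrix (Fin p) (Fin d) ℝ}
  {Γ₀ : Matrix (Fin p) (Fin (p - d)) ℝ} {s : Fin d → ℝ} {Ψ₁ : Matrix (Fin h) (Fin d) ℝ}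
  {Ψ₀ : Matrix (Fin h) (Fin (h - d)) ℝ}

theorem transpose_mul_self_of_fromCols {a b c : ℕ} {A : Matrix (Fin a) (Fin b) ℝ}
    {B : Matrix (Fin a) (Fin c) ℝ}
    (h : (Matrix.fromCols A B)ᵀ * Matrix.fromCols A B = 1) : Aᵀ * A = 1 := by
  rw [Matrix.transpose_fromCols, Matrix.fromRows_mul_fromCols, ← Matrix.fromBlocks_one,
    Matrix.fromBlocks_inj] at h
  exact h.1

theorem IsSVD.left (h : IsSVD M Γ₁ Γ₀ s Ψ₁ Ψ₀) : Γ₁ᵀ * Γ₁ = 1 :=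
  transpose_mul_self_of_fromCols h.left_orth

theorem IsSVD.right (h : IsSVD M Γ₁ Γ₀ s Ψ₁ Ψ₀) : Ψ₁ᵀ * Ψ₁ = 1 :=
  transpose_mul_self_of_fromCols h.right_orth

theorem IsSVD.eq_mul (h : IsSVD M Γ₁ Γ₀ s Ψ₁ Ψ₀) : M = Γ₁ * Matrix.diagonal s * Ψ₁ᵀ := by
  rw [h.eq, Matrix.transpose_fromCols, Matrix.fromCols_mul_fromBlocks, Matrix.fromCols_mul_fromRows]
  simp

theorem le_of_transpose_mul_self (hU : Ψ₁ᵀ * Ψ₁ = 1) : d ≤ h := by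
  have h1 : (Ψ₁ᵀ * Ψ₁).rank ≤ Ψ₁ᵀ.rank := Matrix.rank_mul_le_left _ _
  rw [hU, Matrix.rank_one, Fintype.card_fin] at h1
  exact h1.trans (by simpa using Matrix.rank_le_card_width Ψ₁ᵀ)

end SVD

/-! ### Convergence in distribution -/

section Convergence

variable {Ω : Type*} [MeasurableSpace Ω] {P : Measure Ω} [IsProbabilityMeasure P]

theorem tendstoInDistribution_of_map_eq {E Ω₁ Ω₂ : Type*} [TopologicalSpace E] [MeasurableSpace E]
    [OpensMeasurableSpace E] [MeasurableSpace Ω₁] [MeasurableSpace Ω₂] {μ₁ : Measure Ω₁}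
    {μ₂ : Measure Ω₂} [IsProbabilityMeasure μ₁] [IsProbabilityMeasure μ₂] {X : ℕ → Ω → E}
    {Z₁ : Ω₁ → E} {Z₂ : Ω₂ → E} (h : TendstoInDistribution X atTop Z₁ (fun _ => P) μ₁)
    (hZ₂ : AEMeasurable Z₂ μ₂) (hmap : μ₁.map Z₁ = μ₂.map Z₂) :
    TendstoInDistribution X atTop Z₂ (fun _ => P) μ₂ where
  forall_aemeasurable := h.forall_aemeasurable
  aemeasurable_limit := hZ₂
  tendsto := by
    have e : (⟨μ₁.map Z₁, Measure.isProbabilityMeasure_map h.aemeasurable_limit⟩ :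
        ProbabilityMeasure E) = ⟨μ₂.map Z₂, Measure.isProbabilityMeasure_map hZ₂⟩ :=
      Subtype.ext hmap
    exact e ▸ h.tendsto

/-- Convergence in distribution to `0` is convergence to `0` in probability. -/
theorem tendstoInMeasure_zero {Ω' : Type*} [MeasurableSpace Ω'] {μ' : Measure Ω'}
    [IsProbabilityMeasure μ'] {X : ℕ → Ω → ℝ}
    (h : TendstoInDistribution X atTop (fun _ : Ω' => (0 : ℝ)) (fun _ => P) μ') :
    TendstoInMeasure P X atTop (fun _ => 0) := by
  rw [tendstoInMeasure_iff_norm]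
  intro ε hε
  have hF : IsClosed {x : ℝ | ε ≤ ‖x‖} := isClosed_le continuous_const continuous_norm
  have h1 := ProbabilityMeasure.limsup_measure_closed_le_of_tendsto h.tendsto hF
  have h2 : (μ'.map fun _ : Ω' => (0 : ℝ)) {x : ℝ | ε ≤ ‖x‖} = 0 := by
    rw [Measure.map_apply measurable_const hF.measurableSet]
    simp [hε.not_ge]
  have h3 : ∀ n, (P.map (X n)) {x : ℝ | ε ≤ ‖x‖} = P {ω | ε ≤ ‖X n ω - 0‖} := fun n => by
    rw [Measure.map_apply_of_aemeasurable (h.forall_aemeasurable n) hF.measurableSet]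
    simp
  simp only [ProbabilityMeasure.coe_mk, h2, h3] at h1
  exact tendsto_of_le_liminf_of_limsup_le zero_le h1

omit [IsProbabilityMeasure P] in
theorem tendstoInMeasure_of_abs_le {X Y : ℕ → Ω → ℝ} (hXY : ∀ n ω, |X n ω| ≤ Y n ω)
    (hY : TendstoInMeasure P Y atTop (fun _ => 0)) :
    TendstoInMeasure P X atTop (fun _ => 0) := by
  rw [tendstoInMeasure_iff_norm] at hY ⊢
  intro ε hε
  refine tendsto_of_tendsto_of_tendsto_of_le_of_le tendsto_const_nhds (hY ε hε)
    (fun _ => zero_le) fun n => measure_mono fun ω hω => ?_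
  simp only [Set.mem_ofPred_eq, sub_zero, Real.norm_eq_abs] at hω ⊢
  exact hω.trans ((hXY n ω).trans (le_abs_self _))

/-- The multivariate central limit theorem, for a centered Gaussian limit given by its
characteristic function. -/
theorem tendstoInDistribution_sum {E : Type*} [NormedAddCommGroup E] [InnerProductSpace ℝ E]
    [FiniteDimensional ℝ E] [MeasurableSpace E] [BorelSpace E] {ξ : ℕ → Ω → E}
    (hξ : MemLp (ξ 0) 2 P) (h0 : ∀ t, ∫ ω, inner ℝ (ξ 0 ω) t ∂P = 0)
    (hindep : iIndepFun ξ P) (hident : ∀ i, IdentDistrib (ξ i) (ξ 0) P P)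
    {γ : Measure E} [IsProbabilityMeasure γ]
    (hγ : ∀ t, charFun γ t = Complex.exp (-((∫ ω, inner ℝ (ξ 0 ω) t ^ 2 ∂P : ℝ) : ℂ) / 2)) :
    TendstoInDistribution (fun (n : ℕ) ω => (√n)⁻¹ • ∑ k ∈ Finset.range n, ξ k ω) atTop id
      (fun _ => P) γ := by
  have hm : ∀ n : ℕ, AEMeasurable (fun ω => (√n)⁻¹ • ∑ k ∈ Finset.range n, ξ k ω) P := fun n =>
    (Finset.aemeasurable_fun_sum _ fun k _ => (hident k).aemeasurable_fst).const_smul _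
  refine ⟨hm, aemeasurable_id, ?_⟩
  refine ProbabilityMeasure.tendsto_iff_tendsto_charFun.2 fun t => ?_
  have hmt : Measurable fun x : E => inner ℝ x t := by fun_prop
  have hξt : MemLp (fun ω => inner ℝ (ξ 0 ω) t) 2 P := hξ.inner_const t
  have hvar : Var[fun ω => inner ℝ (ξ 0 ω) t; P] = ∫ ω, inner ℝ (ξ 0 ω) t ^ 2 ∂P :=
    variance_of_integral_eq_zero hξt.aestronglyMeasurable.aemeasurable (h0 t)
  have clt := tendstoInDistribution_inv_sqrt_mul_sum_sub
    (X := fun k ω => inner ℝ (ξ k ω) t) (P := P) (Y := id)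
    (P' := gaussianReal 0 Var[fun ω => inner ℝ (ξ 0 ω) t; P].toNNReal)
    HasLaw.id hξt (hindep.comp (fun _ x => inner ℝ x t) fun _ => hmt)
    (fun i => (hident i).comp hmt)
  have h1 := ProbabilityMeasure.tendsto_iff_tendsto_charFun.1 clt.tendsto 1
  simp only [ProbabilityMeasure.coe_mk, Measure.map_id, charFun_gaussianReal] at h1 ⊢
  rw [hγ t]
  convert! h1 using 2 with n
  · rw [charFun_apply, charFun_apply_real, integral_map (hm n) (by fun_prop),
      integral_map (clt.forall_aemeasurable n) (by fun_prop)]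
    refine integral_congr_ae (ae_of_all _ fun ω => ?_)
    simp only [h0 t, real_inner_smul_left, sum_inner]
    simp
  · rw [Real.coe_toNNReal _ (variance_nonneg _ _), hvar]
    simp [neg_div]

end Convergence

/-! ### Weighted sums of chi-squared variables -/

section ChiSquared

theorem chiSquared_one_eq : chiSquared 1 = (gaussianReal 0 1).map fun x => x ^ 2 := by
  have h1 : (Measure.pi fun _ : Fin 1 => gaussianReal 0 1).map (fun x => x 0) =
      gaussianReal 0 1 := (measurePreserving_eval (fun _ : Fin 1 => gaussianReal 0 1) 0).map_eq
  rw [← h1, Measure.map_map (by fun_prop) (by fun_prop), chiSquared]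
  congr 1
  ext x
  simp

variable {ι : Type*} [Fintype ι] [DecidableEq ι]

theorem norm_sq_toEuclideanCLM_sqrt {S : Matrix ι ι ℝ} (hS : S.PosSemidef)
    (v : EuclideanSpace ℝ ι) :
    ‖Matrix.toEuclideanCLM (𝕜 := ℝ) (n := ι) (CFC.sqrt S) v‖ ^ 2 =
      inner ℝ v (Matrix.toEuclideanCLM (𝕜 := ℝ) (n := ι) S v) := by
  have hsa : IsSelfAdjoint (Matrix.toEuclideanCLM (𝕜 := ℝ) (n := ι) (CFC.sqrt S)) :=
    (CFC.sqrt_nonneg S).isSelfAdjoint.map _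
  rw [← real_inner_self_eq_norm_sq, ← ContinuousLinearMap.adjoint_inner_right, hsa.adjoint_eq,
    ← ContinuousLinearMap.comp_apply, ← ContinuousLinearMap.mul_def, ← map_mul,
    CFC.sqrt_mul_sqrt_self _ hS.nonneg]

/-- The squared norm of a centered Gaussian vector is distributed as a sum of independent
chi-squared variables weighted by the eigenvalues of the covariance matrix. -/
theorem map_norm_sq_multivariateGaussian {S : Matrix ι ι ℝ} (hS : S.PosSemidef) :
    (multivariateGaussian 0 S).map (fun v => ‖v‖ ^ 2) =
      (Measure.pi fun _ : Fin (Fintype.card ι) => chiSquared 1).map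
        fun q => ∑ i, hS.isHermitian.eigenvalues₀ i * q i := by
  let e : ι ≃ Fin (Fintype.card ι) := (Fintype.equivOfCardEq (Fintype.card_fin _)).symm
  let b : OrthonormalBasis (Fin (Fintype.card ι)) ℝ (EuclideanSpace ℝ ι) :=
    hS.isHermitian.eigenvectorBasis.reindex e
  have hb : ∀ i, Matrix.toEuclideanCLM (𝕜 := ℝ) (n := ι) S (b i) =
      hS.isHermitian.eigenvalues₀ i • b i := fun i => by
    have h1 := hS.isHermitian.mulVec_eigenvectorBasis (e.symm i)
    have h2 : hS.isHermitian.eigenvalues (e.symm i) = hS.isHermitian.eigenvalues₀ i := by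
      change hS.isHermitian.eigenvalues₀ (e (e.symm i)) = _
      rw [e.apply_symm_apply]
    rw [h2] at h1
    ext j
    rw [Matrix.ofLp_toEuclideanCLM]
    simpa [b] using congrFun h1 j
  have hnorm : ∀ x : Fin (Fintype.card ι) → ℝ,
      ‖Matrix.toEuclideanCLM (𝕜 := ℝ) (n := ι) (CFC.sqrt S) (∑ i, x i • b i)‖ ^ 2 =
        ∑ i, hS.isHermitian.eigenvalues₀ i * x i ^ 2 := fun x => by
    rw [norm_sq_toEuclideanCLM_sqrt hS, map_sum]
    simp_rw [map_smul, hb, smul_smul]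
    rw [b.orthonormal.inner_sum]
    exact Finset.sum_congr rfl fun i _ => by simp; ring
  have hpi : (Measure.pi fun _ : Fin (Fintype.card ι) => chiSquared 1) =
      (Measure.pi fun _ : Fin (Fintype.card ι) => gaussianReal 0 1).map fun x i => x i ^ 2 := by
    rw [chiSquared_one_eq]
    have : IsProbabilityMeasure ((gaussianReal 0 1).map fun x => x ^ 2) :=
      Measure.isProbabilityMeasure_map (by fun_prop)
    exact (Measure.pi_map_pi (fun _ => by fun_prop)).symm
  rw [multivariateGaussian, stdGaussian_eq_map_pi_orthonormalBasis b, hpi,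
    Measure.map_map (by fun_prop) (by fun_prop), Measure.map_map (by fun_prop) (by fun_prop),
    Measure.map_map (by fun_prop) (by fun_prop)]
  congr 1
  ext x
  simp only [Function.comp_apply, zero_add]
  exact hnorm x

end ChiSquared

/-! ### Laws of large numbers for the sample -/

section Consistency

variable {p h r d : ℕ} {ν : Measure (Vec p × Fin h)}
  {Ω : Type*} [MeasurableSpace Ω] {P : Measure Ω}
  {X : ℕ → Ω → Vec p} {Y : ℕ → Ω → Fin h}

theorem tendsto_avg (hlaw : ∀ i, HasLaw (fun ω => (X i ω, Y i ω)) ν P)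
    (hindep : iIndepFun (fun i ω => (X i ω, Y i ω)) P) {f : Vec p × Fin h → ℝ}
    (hfm : Measurable f) (hf : Integrable f ν) :
    ∀ᵐ ω ∂P, Tendsto (fun n : ℕ => avg fun i : Fin n => f (X i ω, Y i ω)) atTop
      (𝓝 (∫ w, f w ∂ν)) := by
  have hint : Integrable (fun ω => f (X 0 ω, Y 0 ω)) P := by
    have := hf
    rw [← (hlaw 0).map_eq] at this
    exact this.comp_aemeasurable (hlaw 0).aemeasurable
  have hident : ∀ i, IdentDistrib (fun ω => f (X i ω, Y i ω)) (fun ω => f (X 0 ω, Y 0 ω)) P P :=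
    fun i => (IdentDistrib.mk (hlaw i).aemeasurable (hlaw 0).aemeasurable
      ((hlaw i).map_eq.trans (hlaw 0).map_eq.symm)).comp hfm
  have hpair : Pairwise (Function.onFun (IndepFun · · P) fun i ω => f (X i ω, Y i ω)) :=
    fun i j hij => (hindep.indepFun hij).comp hfm hfm
  have hmean : ∫ ω, f (X 0 ω, Y 0 ω) ∂P = ∫ w, f w ∂ν :=
    (hlaw 0).integral_comp hfm.aestronglyMeasurable
  filter_upwards [strong_law_ae (fun i ω => f (X i ω, Y i ω)) hint hpair hident] with ω hω
  rw [hmean] at hω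
  refine hω.congr fun n => ?_
  rw [avg, smul_eq_mul, Finset.sum_range]

theorem aemeasurable_avg (hlaw : ∀ i, HasLaw (fun ω => (X i ω, Y i ω)) ν P)
    {f : Vec p × Fin h → ℝ} (hfm : Measurable f) (n : ℕ) :
    AEMeasurable (fun ω => avg fun i : Fin n => f (X i ω, Y i ω)) P := by
  unfold avg
  refine AEMeasurable.const_mul (Finset.aemeasurable_fun_sum _ fun i _ => ?_) _
  exact hfm.comp_aemeasurable (hlaw i).aemeasurable

end Consistency

/-! ### Second moment matrices and centered Gaussian laws -/

section SecondMoment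

variable {Ω : Type*} [MeasurableSpace Ω] {P : Measure Ω} {ι κ : Type*} [Fintype ι]
  [DecidableEq ι] [Fintype κ] [DecidableEq κ]

/-- The matrix `E(ξ ξᵀ)`. -/
def secondMoment (P : Measure Ω) (ξ : Ω → EuclideanSpace ℝ ι) : Matrix ι ι ℝ :=
  Matrix.of fun a b => ∫ ω, ξ ω a * ξ ω b ∂P

variable {ξ : Ω → EuclideanSpace ℝ ι}

omit [DecidableEq ι] in
theorem dotProduct_secondMoment_mulVec (hξ : MemLp ξ 2 P) (t : EuclideanSpace ℝ ι) :
    t ⬝ᵥ secondMoment P ξ *ᵥ t = ∫ ω, inner ℝ (ξ ω) t ^ 2 ∂P := by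
  have hint : ∀ a b, Integrable (fun ω => t a * (ξ ω a * ξ ω b * t b)) P := fun a b =>
    (((hξ.eval_piLp a).integrable_mul (hξ.eval_piLp b)).mul_const _).const_mul _
  have h1 : ∀ ω, inner ℝ (ξ ω) t ^ 2 = ∑ a, ∑ b, t a * (ξ ω a * ξ ω b * t b) := fun ω => by
    rw [PiLp.inner_apply, sq, Finset.sum_mul_sum]
    refine Finset.sum_congr rfl fun a _ => Finset.sum_congr rfl fun b _ => ?_
    simp only [RCLike.inner_apply, conj_trivial]
    ring
  simp_rw [h1]
  rw [integral_finsetSum _ fun a _ => integrable_finsetSum _ fun b _ => hint a b]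
  simp only [dotProduct, Matrix.mulVec, secondMoment, Matrix.of_apply]
  refine Finset.sum_congr rfl fun a _ => ?_
  rw [integral_finsetSum _ fun b _ => hint a b, Finset.mul_sum]
  exact Finset.sum_congr rfl fun b _ => by rw [integral_const_mul, integral_mul_const]

omit [DecidableEq ι] in
theorem posSemidef_secondMoment (hξ : MemLp ξ 2 P) : (secondMoment P ξ).PosSemidef := by
  refine Matrix.PosSemidef.of_dotProduct_mulVec_nonneg ?_ fun v => ?_
  · ext a b
    simp [secondMoment, mul_comm]
  · have := dotProduct_secondMoment_mulVec hξ (WithLp.toLp 2 v)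
    simp only [star_trivial]
    rw [this]
    exact integral_nonneg fun ω => sq_nonneg _

theorem charFun_multivariateGaussian_secondMoment (hξ : MemLp ξ 2 P) (t : EuclideanSpace ℝ ι) :
    charFun (multivariateGaussian 0 (secondMoment P ξ)) t =
      Complex.exp (-((∫ ω, inner ℝ (ξ ω) t ^ 2 ∂P : ℝ) : ℂ) / 2) := by
  rw [charFun_multivariateGaussian (posSemidef_secondMoment hξ),
    dotProduct_secondMoment_mulVec hξ]
  simp [neg_div]

theorem map_multivariateGaussian_secondMoment (hξ : MemLp ξ 2 P)
    (L : EuclideanSpace ℝ ι →L[ℝ] EuclideanSpace ℝ κ) :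
    (multivariateGaussian 0 (secondMoment P ξ)).map L =
      multivariateGaussian 0 (secondMoment P fun ω => L (ξ ω)) := by
  have hL : MemLp (fun ω => L (ξ ω)) 2 P := hξ.continuousLinearMap_comp L
  have : IsProbabilityMeasure ((multivariateGaussian 0 (secondMoment P ξ)).map L) :=
    Measure.isProbabilityMeasure_map (by fun_prop)
  refine Measure.ext_of_charFun ?_
  ext t
  rw [charFun_multivariateGaussian_secondMoment hL, charFun_apply,
    integral_map (by fun_prop) (by fun_prop)]
  simp_rw [← ContinuousLinearMap.adjoint_inner_right]
  rw [← charFun_apply, charFun_multivariateGaussian_secondMoment hξ]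

end SecondMoment

/-! ### The score vector -/

section Score

variable {p h r d : ℕ} (ν : Measure (Vec p × Fin h)) [IsProbabilityMeasure ν]

/-- The products `(X - E X)_j ε_k` together with the centered predictors: the random vector whose
normalized sums drive the statistics. -/
def score (w : Vec p × Fin h) : EuclideanSpace ℝ ((Fin p × Fin h) ⊕ Fin p) :=
  WithLp.toLp 2 (Sum.elim (fun q => (w.1 q.1 - meanX ν q.1) * resid ν w q.2)
    fun j => w.1 j - meanX ν j)

variable {ν}

omit [IsProbabilityMeasure ν] in
theorem measurable_score : Measurable (score ν) := by
  refine (PiLp.continuous_toLp 2 _).measurable.comp (measurable_pi_lambda _ fun q => ?_)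
  rcases q with q | j
  · exact ((measurable_coord q.1).sub_const _).mul (measurable_resid q.2)
  · exact (measurable_coord j).sub_const _

theorem memLp_score (hX : MemLp (fun w : Vec p × Fin h => w.1) 4 ν) : MemLp (score ν) 2 ν := by
  refine MemLp.of_eval_piLp fun q => ?_
  rcases q with q | j
  · have : ENNReal.HolderTriple 4 4 2 := ⟨by
      rw [← two_mul, show (4 : ENNReal) = 2 * 2 by norm_num,
        ENNReal.mul_inv (by norm_num) (by norm_num), ← mul_assoc,
        ENNReal.mul_inv_cancel (by norm_num) (by norm_num), one_mul]⟩
    exact (memLp_resid hX q.2).mul' (memLp_centered hX q.1)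
  · exact (memLp_centered hX j).mono_exponent (by norm_num)

theorem integral_score_apply (hX : MemLp (fun w : Vec p × Fin h => w.1) 4 ν)
    (hcov : (covX ν).PosDef) (q : (Fin p × Fin h) ⊕ Fin p) : ∫ w, score ν w q ∂ν = 0 := by
  rcases q with q | j
  · exact integral_centered_mul_resid hX hcov q.1 q.2
  · exact integral_centered hX j

theorem integral_inner_score (hX : MemLp (fun w : Vec p × Fin h => w.1) 4 ν)
    (hcov : (covX ν).PosDef) (t) : ∫ w, inner ℝ (score ν w) t ∂ν = 0 := by
  simp_rw [PiLp.inner_apply, RCLike.inner_apply, conj_trivial]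
  rw [integral_finsetSum _ fun q _ =>
    (((memLp_score hX).eval_piLp q).integrable (by norm_num)).const_mul _]
  simp [integral_const_mul, integral_score_apply hX hcov]

variable {Ω : Type*} [MeasurableSpace Ω] {P : Measure Ω} [IsProbabilityMeasure P]
  {X : ℕ → Ω → Vec p} {Y : ℕ → Ω → Fin h}

/-- The normalized sums of the scores are asymptotically Gaussian. -/
theorem tendstoInDistribution_score (hX : MemLp (fun w : Vec p × Fin h => w.1) 4 ν)
    (hcov : (covX ν).PosDef) (hlaw : ∀ i, HasLaw (fun ω => (X i ω, Y i ω)) ν P)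
    (hindep : iIndepFun (fun i ω => (X i ω, Y i ω)) P) :
    TendstoInDistribution
      (fun (n : ℕ) ω => (√n)⁻¹ • ∑ i ∈ Finset.range n, score ν (X i ω, Y i ω)) atTop id
      (fun _ => P) (multivariateGaussian 0 (secondMoment ν (score ν))) := by
  have hs := memLp_score hX
  refine tendstoInDistribution_sum (ξ := fun i ω => score ν (X i ω, Y i ω)) ?_ ?_ ?_ ?_ ?_
  · exact MemLp.comp_of_map (g := score ν) (by rw [(hlaw 0).map_eq]; exact hs) (hlaw 0).aemeasurable
  · intro t
    rw [← integral_inner_score hX hcov t]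
    exact (hlaw 0).integral_comp (f := fun w => inner ℝ (score ν w) t)
      (measurable_score.inner_const).aestronglyMeasurable
  · exact hindep.comp (fun _ => score ν) fun _ => measurable_score
  · exact fun i => (IdentDistrib.mk (hlaw i).aemeasurable (hlaw 0).aemeasurable
      ((hlaw i).map_eq.trans (hlaw 0).map_eq.symm)).comp measurable_score
  · intro t
    rw [charFun_multivariateGaussian_secondMoment hs]
    congr 4
    exact ((hlaw 0).integral_comp (f := fun w => inner ℝ (score ν w) t ^ 2)
      (measurable_score.inner_const.pow_const 2).aestronglyMeasurable).symm

/-- The linear map that sends the limit of the normalized scores to the limit of `scaledVec`. -/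
def limitMap (R : Matrix (Fin r) (Fin p) ℝ) (D : Fin h → ℝ) (Ψ : Matrix (Fin h) (Fin d) ℝ) :
    EuclideanSpace ℝ ((Fin p × Fin h) ⊕ Fin p) →L[ℝ] EuclideanSpace ℝ (Fin d × Fin r) :=
  LinearMap.toContinuousLinearMap
    { toFun := fun N => WithLp.toLp 2 fun q =>
        ∑ k, Ψ k q.1 * ((∑ j, R q.2 j * N (Sum.inl (j, k))) * D k)
      map_add' := fun N N' => by
        ext q
        simp [mul_add, add_mul, Finset.sum_add_distrib]
      map_smul' := fun c N => by
        ext q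
        simp only [PiLp.smul_apply, smul_eq_mul, RingHom.id_apply, Finset.mul_sum,
          Finset.sum_mul]
        exact Finset.sum_congr rfl fun k _ => Finset.sum_congr rfl fun j _ => by ring }

theorem limitMap_apply (R : Matrix (Fin r) (Fin p) ℝ) (D : Fin h → ℝ)
    (Ψ : Matrix (Fin h) (Fin d) ℝ) (N) (q : Fin d × Fin r) :
    limitMap R D Ψ N q = ∑ k, Ψ k q.1 * ((∑ j, R q.2 j * N (Sum.inl (j, k))) * D k) := rfl

omit [IsProbabilityMeasure ν] in
theorem Dg_inv (hslices : ∀ k, 0 < sliceProb ν k) : (Dg ν)⁻¹ = scalePop ν := by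
  refine Matrix.inv_eq_right_inv ?_
  rw [scalePop, Dg, Matrix.diagonal_mul_diagonal, ← Matrix.diagonal_one]
  congr 1
  ext k
  exact mul_inv_cancel₀ (Real.sqrt_pos.2 (hslices k)).ne'

omit [IsProbabilityMeasure ν] in
/-- `Ω_{ℋ|d}` is the second moment matrix of the linear image of the score vector. -/
theorem omegaHd_eq (hslices : ∀ k, 0 < sliceProb ν k) (αx : Matrix (Fin p) (Fin r) ℝ)
    (Ψ₁ : Matrix (Fin h) (Fin d) ℝ) :
    omegaHd ν αx Ψ₁ = secondMoment ν fun w => limitMap ((alpha ν αx)ᵀ * invSqrt (covX ν))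
      (fun k => (g ν k)⁻¹) Ψ₁ (score ν w) := by
  ext a b
  rw [omegaHd, secondMoment, Matrix.of_apply, Matrix.of_apply]
  refine integral_congr_ae (ae_of_all _ fun w => ?_)
  have hsplit : ∀ q : Fin d × Fin r,
      limitMap ((alpha ν αx)ᵀ * invSqrt (covX ν)) (fun k => (g ν k)⁻¹) Ψ₁ (score ν w) q =
      ((Ψ₁ᵀ * (Dg ν)⁻¹) *ᵥ resid ν w) q.1 *
        ((alpha ν αx)ᵀ *ᵥ (WithLp.ofLp (stdZ ν w))) q.2 := fun q => by
    have h1 : ((alpha ν αx)ᵀ *ᵥ (WithLp.ofLp (stdZ ν w))) q.2 =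
        ∑ j, ((alpha ν αx)ᵀ * invSqrt (covX ν)) q.2 j * (w.1 j - meanX ν j) := by
      rw [stdZ, mulV, Matrix.mulVec_mulVec]
      rfl
    rw [limitMap_apply, h1, Dg_inv hslices, scalePop, Matrix.mulVec, dotProduct, Finset.sum_mul]
    refine Finset.sum_congr rfl fun k _ => ?_
    rw [Matrix.mul_diagonal, Matrix.transpose_apply]
    simp only [score, Sum.elim_inl, ← mul_assoc]
    rw [← Finset.sum_mul]
    ring
  have hDt : ((Dg ν)⁻¹)ᵀ = (Dg ν)⁻¹ := by rw [Dg_inv hslices, scalePop, Matrix.diagonal_transpose]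
  have hout : ∀ {m q : ℕ} (A : Matrix (Fin m) (Fin q) ℝ) (v : Fin q → ℝ),
      A * Matrix.vecMulVec v v * Aᵀ = Matrix.vecMulVec (A *ᵥ v) (A *ᵥ v) := fun A v => by
    rw [Matrix.mul_vecMulVec, Matrix.vecMulVec_mul, Matrix.vecMul_transpose]
  have e1 : Ψ₁ᵀ * (Dg ν)⁻¹ * Matrix.vecMulVec (resid ν w) (resid ν w) * (Dg ν)⁻¹ * Ψ₁ =
      Matrix.vecMulVec ((Ψ₁ᵀ * (Dg ν)⁻¹) *ᵥ resid ν w) ((Ψ₁ᵀ * (Dg ν)⁻¹) *ᵥ resid ν w) := by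
    rw [← hout, Matrix.transpose_mul, hDt, Matrix.transpose_transpose]
    simp only [Matrix.mul_assoc]
  have e2 := hout (alpha ν αx)ᵀ (WithLp.ofLp (stdZ ν w))
  rw [Matrix.transpose_transpose] at e2
  simp only [omegaIntegrand, e1, e2, Matrix.kroneckerMap_apply, Matrix.vecMulVec_apply, hsplit]
  ring

end Score

/-! ### Consistency of the sample quantities -/

section SampleLimits

variable {p h r d : ℕ} {ν : Measure (Vec p × Fin h)} [IsProbabilityMeasure ν]
  {Ω : Type*} [MeasurableSpace Ω] {P : Measure Ω}
  {X : ℕ → Ω → Vec p} {Y : ℕ → Ω → Fin h}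

theorem ae_tendsto_covHat (hX : MemLp (fun w : Vec p × Fin h => w.1) 4 ν)
    (hlaw : ∀ i, HasLaw (fun ω => (X i ω, Y i ω)) ν P)
    (hindep : iIndepFun (fun i ω => (X i ω, Y i ω)) P) :
    ∀ᵐ ω ∂P, Tendsto (fun n : ℕ => covHat fun i : Fin n => X i ω) atTop (𝓝 (covX ν)) := by
  have hm : ∀ j, MemLp (fun w : Vec p × Fin h => w.1 j) 2 ν := fun j =>
    (memLp_coord hX j).mono_exponent (by norm_num)
  have h1 : ∀ᵐ ω ∂P, ∀ j, Tendsto (fun n : ℕ => avg fun i : Fin n => X i ω j) atTop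
      (𝓝 (∫ w, w.1 j ∂ν)) := ae_all_iff.2 fun j =>
    tendsto_avg hlaw hindep (measurable_coord j) ((hm j).integrable (by norm_num))
  have h2 : ∀ᵐ ω ∂P, ∀ j l, Tendsto (fun n : ℕ => avg fun i : Fin n => X i ω j * X i ω l) atTop
      (𝓝 (∫ w, w.1 j * w.1 l ∂ν)) := ae_all_iff.2 fun j => ae_all_iff.2 fun l =>
    tendsto_avg hlaw hindep ((measurable_coord j).mul (measurable_coord l))
      ((hm j).integrable_mul (hm l))
  filter_upwards [h1, h2] with ω h1 h2
  rw [tendsto_matrix_iff]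
  intro j l
  simp_rw [covHat_apply, avg_centered_mul]
  rw [covX, Matrix.of_apply, covariance_eq_sub (hm j) (hm l)]
  exact (h2 j l).sub ((h1 j).mul (h1 l))

theorem ae_tendsto_crossHat (hX : MemLp (fun w : Vec p × Fin h => w.1) 4 ν)
    (hlaw : ∀ i, HasLaw (fun ω => (X i ω, Y i ω)) ν P)
    (hindep : iIndepFun (fun i ω => (X i ω, Y i ω)) P) :
    ∀ᵐ ω ∂P, Tendsto (fun n : ℕ => crossHat (fun i : Fin n => X i ω) fun i : Fin n => Y i ω)
      atTop (𝓝 (crossPop ν)) := by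
  have hm : ∀ j, MemLp (fun w : Vec p × Fin h => w.1 j) 2 ν := fun j =>
    (memLp_coord hX j).mono_exponent (by norm_num)
  have h1 : ∀ᵐ ω ∂P, ∀ j, Tendsto (fun n : ℕ => avg fun i : Fin n => X i ω j) atTop
      (𝓝 (∫ w, w.1 j ∂ν)) := ae_all_iff.2 fun j =>
    tendsto_avg hlaw hindep (measurable_coord j) ((hm j).integrable (by norm_num))
  have h2 : ∀ᵐ ω ∂P, ∀ j k, Tendsto
      (fun n : ℕ => avg fun i : Fin n => X i ω j * J k (X i ω, Y i ω)) atTop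
      (𝓝 (∫ w, w.1 j * J k w ∂ν)) := ae_all_iff.2 fun j => ae_all_iff.2 fun k =>
    tendsto_avg hlaw hindep (f := fun w => w.1 j * J k w)
      ((measurable_coord j).mul (measurable_J k)) ((hm j).integrable_mul (memLp_J k 2))
  have h3 : ∀ᵐ ω ∂P, ∀ k, Tendsto (fun n : ℕ => avg fun i : Fin n =>
      (J k (X i ω, Y i ω) : ℝ)) atTop (𝓝 (∫ w, J k w ∂ν)) := ae_all_iff.2 fun k =>
    tendsto_avg hlaw hindep (measurable_J k) ((memLp_J k 2).integrable (by norm_num))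
  filter_upwards [h1, h2, h3] with ω h1 h2 h3
  rw [tendsto_matrix_iff]
  intro j k
  simp only [crossHat, Matrix.of_apply, avg_centered_mul]
  rw [crossPop, Matrix.of_apply, covariance_eq_sub (hm j) (memLp_J k 2)]
  exact (h2 j k).sub ((h1 j).mul (h3 k))

theorem ae_tendsto_fHat (hlaw : ∀ i, HasLaw (fun ω => (X i ω, Y i ω)) ν P)
    (hindep : iIndepFun (fun i ω => (X i ω, Y i ω)) P) :
    ∀ᵐ ω ∂P, ∀ k, Tendsto (fun n : ℕ => fHat (fun i : Fin n => Y i ω) k) atTop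
      (𝓝 (sliceProb ν k)) := by
  refine ae_all_iff.2 fun k => ?_
  have := tendsto_avg hlaw hindep (measurable_J k) ((memLp_J k 2).integrable (by norm_num))
  rw [integral_J] at this
  filter_upwards [this] with ω hω
  refine hω.congr fun n => ?_
  rw [fHat_eq_avg (fun i : Fin n => X i ω)]

theorem ae_tendsto_inv_sqrt_fHat (hlaw : ∀ i, HasLaw (fun ω => (X i ω, Y i ω)) ν P)
    (hindep : iIndepFun (fun i ω => (X i ω, Y i ω)) P) (hslices : ∀ k, 0 < sliceProb ν k) :
    ∀ᵐ ω ∂P, ∀ k, Tendsto (fun n : ℕ => (√(fHat (fun i : Fin n => Y i ω) k))⁻¹) atTop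
      (𝓝 (g ν k)⁻¹) := by
  filter_upwards [ae_tendsto_fHat hlaw hindep] with ω hω k
  exact ((Real.continuous_sqrt.tendsto _).comp (hω k)).inv₀ (Real.sqrt_pos.2 (hslices k)).ne'

theorem ae_tendsto_zMat (hX : MemLp (fun w : Vec p × Fin h => w.1) 4 ν)
    (hcov : (covX ν).PosDef) (hslices : ∀ k, 0 < sliceProb ν k)
    (hlaw : ∀ i, HasLaw (fun ω => (X i ω, Y i ω)) ν P)
    (hindep : iIndepFun (fun i ω => (X i ω, Y i ω)) P) :
    ∀ᵐ ω ∂P, Tendsto (fun n : ℕ => zMat (fun i : Fin n => X i ω) fun i : Fin n => Y i ω)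
      atTop (𝓝 (muMat ν)) := by
  filter_upwards [ae_tendsto_covHat hX hlaw hindep, ae_tendsto_crossHat hX hlaw hindep,
    ae_tendsto_inv_sqrt_fHat hlaw hindep hslices] with ω h1 h2 h3
  simp_rw [zMat_eq]
  rw [muMat_eq hX]
  refine tendsto_matrix_mul (tendsto_matrix_mul
    (tendsto_invSqrt hcov (fun n => posSemidef_covHat _) h1) h2) ?_
  rw [tendsto_matrix_iff]
  intro k l
  by_cases hkl : k = l
  · subst hkl
    simpa [scaleHat, scalePop] using h3 k
  · simp [scaleHat, scalePop, Matrix.diagonal_apply_ne _ hkl]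

variable (hlaw : ∀ i, HasLaw (fun ω => (X i ω, Y i ω)) ν P) (n : ℕ)

omit [IsProbabilityMeasure ν] in
include hlaw in
theorem aemeasurable_covHat : AEMeasurable (fun ω => covHat fun i : Fin n => X i ω) P := by
  refine aemeasurable_pi_lambda _ fun j => aemeasurable_pi_lambda _ fun l => ?_
  simp_rw [covHat_apply, avg_centered_mul]
  exact (aemeasurable_avg hlaw (f := fun w => w.1 j * w.1 l)
    ((measurable_coord j).mul (measurable_coord l)) n).sub
    ((aemeasurable_avg hlaw (measurable_coord j) n).mul
      (aemeasurable_avg hlaw (measurable_coord l) n))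

omit [IsProbabilityMeasure ν] in
include hlaw in
theorem aemeasurable_inv_sqrt_fHat (k : Fin h) :
    AEMeasurable (fun ω => (√(fHat (fun i : Fin n => Y i ω) k))⁻¹) P := by
  have h1 : ∀ ω, fHat (fun i : Fin n => Y i ω) k = avg fun i : Fin n => J k (X i ω, Y i ω) :=
    fun ω => fHat_eq_avg (fun i : Fin n => X i ω) (fun i : Fin n => Y i ω) k
  simp_rw [h1]
  exact (aemeasurable_avg hlaw (measurable_J k) n).sqrt.inv

omit [IsProbabilityMeasure ν] in
include hlaw in
theorem aemeasurable_zMat :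
    AEMeasurable (fun ω => zMat (fun i : Fin n => X i ω) fun i : Fin n => Y i ω) P := by
  simp_rw [zMat_eq]
  refine aemeasurable_matrix_mul (aemeasurable_matrix_mul
    (measurable_invSqrt.comp_aemeasurable (aemeasurable_covHat hlaw n)) ?_) ?_
  · refine aemeasurable_pi_lambda _ fun j => aemeasurable_pi_lambda _ fun k => ?_
    simp only [crossHat, Matrix.of_apply, avg_centered_mul]
    exact (aemeasurable_avg hlaw (f := fun w => w.1 j * J k w)
      ((measurable_coord j).mul (measurable_J k)) n).sub
      ((aemeasurable_avg hlaw (measurable_coord j) n).mul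
        (aemeasurable_avg hlaw (measurable_J k) n))
  · refine aemeasurable_pi_lambda _ fun k => aemeasurable_pi_lambda _ fun l => ?_
    by_cases hkl : k = l
    · subst hkl
      simpa [scaleHat] using aemeasurable_inv_sqrt_fHat hlaw n k
    · simp [scaleHat, Matrix.diagonal_apply_ne _ hkl]

end SampleLimits

/-! ### The normalized matrix `√n α̂ᵀ ℤ_n` -/

section NormalizedMatrix

variable {p h r d n : ℕ}

/-- `√n α̂ᵀ ℤ_n`. -/
def normMat (x : Fin n → Vec p) (y : Fin n → Fin h) (αx : Matrix (Fin p) (Fin r) ℝ) :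
    Matrix (Fin r) (Fin h) ℝ :=
  √n • ((alphaOf (covHat x) αx)ᵀ * zMat x y)

theorem frobSq_normMat (x : Fin n → Vec p) (y : Fin n → Fin h) (αx : Matrix (Fin p) (Fin r) ℝ) :
    frobSq (normMat x y αx) = n * frobSq ((alphaOf (covHat x) αx)ᵀ * zMat x y) := by
  rw [normMat, frobSq_smul, Real.sq_sqrt (Nat.cast_nonneg n)]

theorem scaledVec_apply (x : Fin n → Vec p) (y : Fin n → Fin h) (αx : Matrix (Fin p) (Fin r) ℝ)
    (Ψ₁ : Matrix (Fin h) (Fin d) ℝ) (q : Fin d × Fin r) :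
    scaledVec x y αx Ψ₁ q = ∑ k, Ψ₁ k q.1 * normMat x y αx q.2 k := by
  simp only [scaledVec, Matrix.mulVec, dotProduct, Fintype.sum_prod_type,
    Matrix.kroneckerMap_apply, Matrix.transpose_apply]
  refine Finset.sum_congr rfl fun k _ => ?_
  rw [Finset.sum_eq_single q.2]
  · rw [Matrix.one_apply_eq, mul_one]
    rfl
  · intro b _ hb
    rw [Matrix.one_apply_ne hb.symm]
    simp
  · simp

theorem norm_sq_scaledVec (x : Fin n → Vec p) (y : Fin n → Fin h)
    (αx : Matrix (Fin p) (Fin r) ℝ) (Ψ₁ : Matrix (Fin h) (Fin d) ℝ) :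
    ‖scaledVec x y αx Ψ₁‖ ^ 2 = n * frobSq ((alphaOf (covHat x) αx)ᵀ * zMat x y * Ψ₁) := by
  have h1 : ∀ q : Fin d × Fin r, scaledVec x y αx Ψ₁ q = (normMat x y αx * Ψ₁) q.2 q.1 :=
    fun q => by
      rw [scaledVec_apply, Matrix.mul_apply]
      exact Finset.sum_congr rfl fun k _ => mul_comm _ _
  have h2 : normMat x y αx * Ψ₁ = √n • ((alphaOf (covHat x) αx)ᵀ * zMat x y * Ψ₁) := by
    rw [normMat, Matrix.smul_mul]
  rw [EuclideanSpace.real_norm_sq_eq, Fintype.sum_prod_type_right]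
  simp_rw [h1]
  rw [← Real.sq_sqrt (Nat.cast_nonneg (α := ℝ) n), ← frobSq_smul, ← h2]
  rfl

/-- The statistic differs from the squared norm of `scaledVec` by an explicit bound. -/
theorem abs_condCoordStat_sub_le (hdp : d + r ≤ p) (hdh : d ≤ h)
    {αx : Matrix (Fin p) (Fin r) ℝ} (hαx : αx.rank = r) (x : Fin n → Vec p) (y : Fin n → Fin h)
    {μ : Matrix (Fin p) (Fin h) ℝ} {Γ : Matrix (Fin p) (Fin d) ℝ} (hΓ : Γᵀ * Γ = 1)
    {s : Fin d → ℝ} {c : ℝ} (hc : 0 < c) (hs : ∀ i, c ≤ s i ^ 2)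
    {U : Matrix (Fin h) (Fin d) ℝ} (hU : Uᵀ * U = 1) (hμ : μ = Γ * Matrix.diagonal s * Uᵀ) :
    |condCoordStat x y αx d - ‖scaledVec x y αx U‖ ^ 2| ≤
      h ^ 2 * frobSq (normMat x y αx) * √(4 / c * (gramDist (zMat x y) μ +
        gramDist ((1 - alphaOf (covHat x) αx * (alphaOf (covHat x) αx)ᵀ) * zMat x y) μ)) := by
  have h1 := abs_topEnergy_sub_le hdh (M := zMat x y)
    (alphaOf_mul_transpose_idem (posSemidef_covHat x) hαx) hΓ hc hs hU hμ
  have h2 := mul_le_mul_of_nonneg_left h1 (Nat.cast_nonneg (α := ℝ) n)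
  rw [← abs_of_nonneg (Nat.cast_nonneg (α := ℝ) n), ← abs_mul,
    abs_of_nonneg (Nat.cast_nonneg (α := ℝ) n)] at h2
  rw [condCoordStat_eq x y hdp hdh αx hαx, norm_sq_scaledVec, frobSq_normMat, ← mul_sub]
  refine h2.trans_eq ?_
  ring

/-- `√n α̂ᵀ ℤ_n` as a function of the normalized scores `N` and of consistent estimates: `R` of
`αᵀ Σ^{-1/2}`, `e` of the mean residuals (zero in the limit) and `D` of the diagonal of `D_g⁻¹`. -/
def linearForm (z : EuclideanSpace ℝ ((Fin p × Fin h) ⊕ Fin p) ×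
    ((Fin r → Fin p → ℝ) × (Fin h → ℝ) × (Fin h → ℝ))) : Fin r → Fin h → ℝ :=
  fun a k => (∑ j, z.2.1 a j * (z.1 (Sum.inl (j, k)) - z.1 (Sum.inr j) * z.2.2.1 k)) * z.2.2.2 k

theorem continuous_linearForm : Continuous (linearForm (p := p) (h := h) (r := r)) := by
  unfold linearForm
  fun_prop

variable {ν : Measure (Vec p × Fin h)}

/-- The sample covariances are those predicted by the population regressions plus the sample
covariances with the residuals. -/
theorem crossHat_eq (x : Fin n → Vec p) (y : Fin n → Fin h) : crossHat x y =
    covHat x * betaMat ν + Matrix.of fun j k =>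
      avg fun i => (x i j - avg fun i => x i j) * resid ν (x i, y i) k := by
  ext j k
  have h1 : ∀ i, (x i j - avg fun i => x i j) * J k (x i, y i) =
      (∑ l, betaMat ν l k * ((x i j - avg fun i => x i j) * (x i l - meanX ν l))) +
        (x i j - avg fun i => x i j) * (resid ν (x i, y i) k - -sliceProb ν k) := fun i => by
    have : ∑ l, betaMat ν l k * ((x i j - avg fun i => x i j) * (x i l - meanX ν l)) =
        (x i j - avg fun i => x i j) * ∑ l, betaMat ν l k * (x i l - meanX ν l) := by
      rw [Finset.mul_sum]
      exact Finset.sum_congr rfl fun l _ => by ring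
    rw [this, resid_eq]
    ring
  rw [Matrix.add_apply, crossHat, Matrix.of_apply, Matrix.of_apply, Matrix.mul_apply]
  simp_rw [h1]
  rw [avg_add, avg_sum, avg_centered_mul_sub_const]
  congr 1
  refine Finset.sum_congr rfl fun l _ => ?_
  rw [avg_const_mul, avg_centered_mul_sub_const, covHat_apply, mul_comm]

theorem avg_centered_mul_eq (u v : Fin n → ℝ) (m : ℝ) :
    avg (fun i => (u i - avg u) * v i) =
      avg (fun i => (u i - m) * v i) - avg (fun i => u i - m) * avg v := by
  rcases Nat.eq_zero_or_pos n with rfl | hn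
  · simp [avg]
  · have hn' : (n : ℝ) ≠ 0 := by positivity
    have h1 : avg (fun _ : Fin n => m) = m := by simp [avg, hn']
    have h2 : (fun i => (u i - m) * v i) = fun i => u i * v i - m * v i := by
      ext i
      ring
    rw [avg_centered_mul, h2, avg_sub (fun i => u i * v i), avg_const_mul, avg_sub u fun _ => m, h1]
    ring

theorem normMat_eq_linearForm {αx : Matrix (Fin p) (Fin r) ℝ} (hβ : αxᵀ * betaMat ν = 0)
    (X : ℕ → Vec p) (Y : ℕ → Fin h) (hu : IsUnit (covHat fun i : Fin n => X i).det) :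
    normMat (fun i : Fin n => X i) (fun i : Fin n => Y i) αx = linearForm
      ((√n)⁻¹ • ∑ i ∈ Finset.range n, score ν (X i, Y i),
        invSqrt (αxᵀ * (covHat fun i : Fin n => X i)⁻¹ * αx) * αxᵀ *
          (covHat fun i : Fin n => X i)⁻¹,
        fun k => avg fun i : Fin n => resid ν (X i, Y i) k,
        fun k => (√(fHat (fun i : Fin n => Y i) k))⁻¹) := by
  set x : Fin n → Vec p := fun i => X i
  set y : Fin n → Fin h := fun i => Y i
  have hN : ∀ q, ((√n)⁻¹ • ∑ i ∈ Finset.range n, score ν (X i, Y i) :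
      EuclideanSpace ℝ ((Fin p × Fin h) ⊕ Fin p)) q = √n * avg fun i => score ν (x i, y i) q :=
    fun q => by
      rw [PiLp.smul_apply, WithLp.ofLp_sum, Finset.sum_apply, Finset.sum_range, avg, smul_eq_mul,
        ← mul_assoc]
      congr 1
      rw [← div_eq_mul_inv, Real.sqrt_div_self]
  have h1 : normMat x y αx = √n • (invSqrt (αxᵀ * (covHat x)⁻¹ * αx) * αxᵀ * (covHat x)⁻¹ *
      (Matrix.of fun j k => avg fun i => (x i j - avg fun i => x i j) * resid ν (x i, y i) k) *
      scaleHat y) := by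
    rw [normMat, alphaOf_transpose_mul_zMat, crossHat_eq (ν := ν), Matrix.mul_add]
    congr 2
    have : invSqrt (αxᵀ * (covHat x)⁻¹ * αx) * αxᵀ * (covHat x)⁻¹ * (covHat x * betaMat ν) = 0 := by
      rw [Matrix.mul_assoc _ (covHat x)⁻¹, Matrix.nonsing_inv_mul_cancel_left _ _ hu,
        Matrix.mul_assoc, hβ, Matrix.mul_zero]
    rw [this, zero_add]
  rw [h1]
  ext a k
  rw [Matrix.smul_apply, scaleHat, Matrix.mul_diagonal, Matrix.mul_apply, linearForm]
  simp only [hN]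
  rw [smul_eq_mul, ← mul_assoc, Finset.mul_sum]
  congr 1
  refine Finset.sum_congr rfl fun j _ => ?_
  rw [Matrix.of_apply, avg_centered_mul_eq (fun i => x i j) _ (meanX ν j)]
  simp only [score, Sum.elim_inl, Sum.elim_inr]
  ring

end NormalizedMatrix

/-! ### The limit laws -/

section Limit

variable {p h r d : ℕ} {ν : Measure (Vec p × Fin h)} [IsProbabilityMeasure ν]
  {Ω : Type*} [MeasurableSpace Ω] {P : Measure Ω} [IsProbabilityMeasure P]
  {X : ℕ → Ω → Vec p} {Y : ℕ → Ω → Fin h} {αx : Matrix (Fin p) (Fin r) ℝ}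

/-- `√n α̂ᵀ ℤ_n` converges in distribution to a linear image of a Gaussian vector. -/
theorem tendstoInDistribution_normMat (hX : MemLp (fun w : Vec p × Fin h => w.1) 4 ν)
    (hcov : (covX ν).PosDef) (hslices : ∀ k, 0 < sliceProb ν k)
    (hlaw : ∀ i, HasLaw (fun ω => (X i ω, Y i ω)) ν P)
    (hindep : iIndepFun (fun i ω => (X i ω, Y i ω)) P) (hαx : αx.rank = r)
    (hβ : αxᵀ * betaMat ν = 0) :
    TendstoInDistribution (E := Fin r → Fin h → ℝ)
      (fun (n : ℕ) ω => normMat (fun i : Fin n => X i ω) (fun i : Fin n => Y i ω) αx) atTop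
      (fun N => linearForm (N, (alpha ν αx)ᵀ * invSqrt (covX ν), 0, fun k => (g ν k)⁻¹))
      (fun _ => P) (multivariateGaussian 0 (secondMoment ν (score ν))) := by
  -- the consistent estimates of the coefficients of the linear form
  let R : ℕ → Ω → Fin r → Fin p → ℝ := fun n ω =>
    invSqrt (αxᵀ * (covHat fun i : Fin n => X i ω)⁻¹ * αx) * αxᵀ *
      (covHat fun i : Fin n => X i ω)⁻¹
  let e : ℕ → Ω → Fin h → ℝ := fun n ω k => avg fun i : Fin n => resid ν (X i ω, Y i ω) k
  let D : ℕ → Ω → Fin h → ℝ := fun n ω k => (√(fHat (fun i : Fin n => Y i ω) k))⁻¹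
  have hRm : ∀ n, AEMeasurable (R n) P := fun n => by
    have hc := aemeasurable_covHat hlaw n
    have hi := measurable_inv.comp_aemeasurable hc
    exact aemeasurable_matrix_mul (aemeasurable_matrix_mul (measurable_invSqrt.comp_aemeasurable
      (aemeasurable_matrix_mul (aemeasurable_matrix_mul aemeasurable_const hi)
        aemeasurable_const)) aemeasurable_const) hi
  have hem : ∀ n, AEMeasurable (e n) P := fun n =>
    aemeasurable_pi_lambda _ fun k => aemeasurable_avg hlaw (measurable_resid k) n
  have hDm : ∀ n, AEMeasurable (D n) P := fun n =>
    aemeasurable_pi_lambda _ fun k => aemeasurable_inv_sqrt_fHat hlaw n k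
  have hem0 : ∀ᵐ ω ∂P, Tendsto (fun n => e n ω) atTop (𝓝 0) := by
    have : ∀ᵐ ω ∂P, ∀ k, Tendsto (fun n => e n ω k) atTop (𝓝 0) := ae_all_iff.2 fun k => by
      have := tendsto_avg hlaw hindep (measurable_resid (ν := ν) k)
        ((memLp_resid hX k).integrable (by norm_num))
      rwa [integral_resid hX] at this
    filter_upwards [this] with ω hω
    exact tendsto_pi_nhds.2 hω
  have hcoef : ∀ᵐ ω ∂P, Tendsto (fun n => (R n ω, e n ω, D n ω)) atTop
      (𝓝 ((alpha ν αx)ᵀ * invSqrt (covX ν), 0, fun k => (g ν k)⁻¹)) := by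
    filter_upwards [ae_tendsto_covHat hX hlaw hindep, hem0,
      ae_tendsto_inv_sqrt_fHat hlaw hindep hslices] with ω h1 h2 h3
    refine Tendsto.prodMk_nhds ?_ (h2.prodMk_nhds (tendsto_pi_nhds.2 h3))
    rw [show alpha ν αx = alphaOf (covX ν) αx from rfl,
      alphaOf_transpose_mul_invSqrt hcov.posSemidef]
    exact tendsto_matrix_mul (tendsto_matrix_mul
      (tendsto_invSqrt_conj hαx hcov (fun n => posSemidef_covHat _) h1) tendsto_const_nhds)
      (tendsto_inv_matrix hcov h1)
  have hcm : ∀ n, AEMeasurable (fun ω => (R n ω, e n ω, D n ω)) P := fun n =>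
    (hRm n).prodMk ((hem n).prodMk (hDm n))
  have slutsky := (tendstoInDistribution_score hX hcov hlaw hindep)
    |>.continuous_comp_prodMk_of_tendstoInMeasure_const
      (continuous_linearForm (p := p) (h := h) (r := r))
      (tendstoInMeasure_of_tendsto_ae (fun n => (hcm n).aestronglyMeasurable) hcoef) hcm
  have hWm : ∀ n : ℕ, AEMeasurable (β := Fin r → Fin h → ℝ)
      (fun ω => normMat (fun i : Fin n => X i ω) (fun i : Fin n => Y i ω) αx) P := fun n => by
    have h1 := aemeasurable_matrix_mul (aemeasurable_matrix_transpose
      (aemeasurable_alphaOf (aemeasurable_covHat hlaw n) αx)) (aemeasurable_zMat hlaw n)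
    exact aemeasurable_pi_lambda _ fun a => aemeasurable_pi_lambda _ fun k =>
      (aemeasurable_pi_iff.1 (aemeasurable_pi_iff.1 h1 a) k).const_mul _
  refine tendstoInDistribution_of_tendstoInMeasure_sub _ _ slutsky ?_ hWm
  -- almost surely the sample covariance matrix is eventually invertible
  refine tendstoInMeasure_of_tendsto_ae (fun n => ((hWm n).sub
    (slutsky.forall_aemeasurable n)).aestronglyMeasurable) ?_
  filter_upwards [ae_tendsto_covHat hX hlaw hindep] with ω hω
  have hdet : Tendsto (fun n : ℕ => (covHat fun i : Fin n => X i ω).det) atTop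
      (𝓝 (covX ν).det) :=
    ((by fun_prop : Continuous fun A : Matrix (Fin p) (Fin p) ℝ => A.det).tendsto _).comp hω
  refine tendsto_const_nhds.congr' ?_
  filter_upwards [hdet.eventually_ne hcov.det_pos.ne'] with n hn
  have := normMat_eq_linearForm hβ (fun i => X i ω) (fun i => Y i ω) (isUnit_iff_ne_zero.2 hn)
  exact (sub_eq_zero.2 this).symm

omit [IsProbabilityMeasure P] in
/-- The Gram matrices of `ℤ_n` and of its projection are consistent. -/
theorem ae_tendsto_gramDist (hX : MemLp (fun w : Vec p × Fin h => w.1) 4 ν)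
    (hcov : (covX ν).PosDef) (hslices : ∀ k, 0 < sliceProb ν k)
    (hlaw : ∀ i, HasLaw (fun ω => (X i ω, Y i ω)) ν P)
    (hindep : iIndepFun (fun i ω => (X i ω, Y i ω)) P) (hαx : αx.rank = r)
    (hαμ : (alpha ν αx)ᵀ * muMat ν = 0) :
    ∀ᵐ ω ∂P, Tendsto (fun n : ℕ =>
      gramDist (zMat (fun i : Fin n => X i ω) fun i : Fin n => Y i ω) (muMat ν) +
      gramDist ((1 - alphaOf (covHat fun i : Fin n => X i ω) αx *
        (alphaOf (covHat fun i : Fin n => X i ω) αx)ᵀ) *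
          zMat (fun i : Fin n => X i ω) fun i : Fin n => Y i ω) (muMat ν)) atTop (𝓝 0) := by
  filter_upwards [ae_tendsto_covHat hX hlaw hindep,
    ae_tendsto_zMat hX hcov hslices hlaw hindep] with ω h1 h2
  have h3 := tendsto_alphaOf hαx hcov (fun n => posSemidef_covHat _) h1
  have h4 := ((by fun_prop : Continuous fun A : Matrix (Fin p) (Fin r) ℝ =>
    1 - A * Aᵀ).tendsto _).comp h3
  have h5 := tendsto_matrix_mul h4 h2
  have h6 : (1 - alphaOf (covX ν) αx * (alphaOf (covX ν) αx)ᵀ) * muMat ν = muMat ν := by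
    rw [Matrix.sub_mul, Matrix.mul_assoc, show (alphaOf (covX ν) αx)ᵀ * muMat ν = 0 from hαμ]
    simp
  rw [h6] at h5
  have hg := (continuous_gramDist_left (muMat ν)).tendsto (muMat ν)
  rw [gramDist_self] at hg
  simpa using (hg.comp h2).add (hg.comp h5)

end Limit

end SIR

end

theorem theorem2 {p h r d : ℕ}
    -- the joint law of `(X, Y)`
    (ν : Measure (SIR.Vec p × Fin h)) [IsProbabilityMeasure ν]
    (hmoments : MemLp (fun w : SIR.Vec p × Fin h => w.1) 4 ν)
    (hcov : (SIR.covX ν).PosDef)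
    (hslices : ∀ y, 0 < SIR.sliceProb ν y)
    -- i.i.d. observations
    {Ω : Type*} [MeasurableSpace Ω] (P : Measure Ω) [IsProbabilityMeasure P]
    (X : ℕ → Ω → SIR.Vec p) (Y : ℕ → Ω → Fin h)
    (hlaw : ∀ i, HasLaw (fun ω => (X i ω, Y i ω)) ν P)
    (hindep : iIndepFun (fun i ω => (X i ω, Y i ω)) P)
    -- the basis that specifies the hypothesis
    (αx : Matrix (Fin p) (Fin r) ℝ) (hαx : αx.rank = r)
    -- the central subspace in the `Z` scale, with its dimension
    (S : Submodule ℝ (SIR.Vec p))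
    (hS : SIR.IsCentralSubspace ν (SIR.measurable_stdZ ν) Prod.snd S)
    (hd : Module.finrank ℝ S = d)
    (hlinearity : SIR.LinearityCondition ν S)
    (hcoverage : SIR.CoverageCondition ν S)
    (hcoordinate : SIR.CoordinateHypothesis ν αx S)
    -- the singular value decomposition of the matrix `μ`
    (Γ₁ : Matrix (Fin p) (Fin d) ℝ) (Γ₀ : Matrix (Fin p) (Fin (p - d)) ℝ) (s : Fin d → ℝ)
    (Ψ₁ : Matrix (Fin h) (Fin d) ℝ) (Ψ₀ : Matrix (Fin h) (Fin (h - d)) ℝ)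
    (hsvd : SIR.IsSVD (SIR.muMat ν) Γ₁ Γ₀ s Ψ₁ Ψ₀) :
    ∃ hpsd : (SIR.omegaHd ν αx Ψ₁).PosSemidef,
      TendstoInDistribution
        (fun (n : ℕ) ω =>
          SIR.scaledVec (fun i : Fin n => X i ω) (fun i : Fin n => Y i ω) αx Ψ₁)
        atTop id (fun _ => P) (multivariateGaussian 0 (SIR.omegaHd ν αx Ψ₁)) ∧
      TendstoInDistribution
        (fun (n : ℕ) ω =>
          SIR.condCoordStat (fun i : Fin n => X i ω) (fun i : Fin n => Y i ω) αx d)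
        atTop
        (fun q : Fin (Fintype.card (Fin d × Fin r)) → ℝ =>
          ∑ i, hpsd.isHermitian.eigenvalues₀ i * q i)
        (fun _ => P) (Measure.pi fun _ => SIR.chiSquared 1) := by
  open SIR Topology in
  let _ := matrixMeasurableSpace
  have _ := matrix_borelSpace
  have hscore := memLp_score hmoments
  have hΩ := omegaHd_eq hslices αx Ψ₁
  have hpsd : (omegaHd ν αx Ψ₁).PosSemidef := by
    rw [hΩ]
    exact posSemidef_secondMoment (hscore.continuousLinearMap_comp _)
  have hαμ := alpha_transpose_mul_muMat hcoverage hcoordinate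
  have hβ := transpose_mul_betaMat hmoments hcov hslices hαx hcoverage hcoordinate
  have hdp : d + r ≤ p := hd ▸ finrank_add_le hcov hαx hcoordinate
  have hdh : d ≤ h := le_of_transpose_mul_self hsvd.right
  have hW := tendstoInDistribution_normMat hmoments hcov hslices hlaw hindep hαx hβ
  -- the first assertion: `scaledVec` is a linear image of the normalized matrix
  let T : (Fin r → Fin h → ℝ) → EuclideanSpace ℝ (Fin d × Fin r) := fun W =>
    WithLp.toLp 2 fun q => ∑ k, Ψ₁ k q.1 * W q.2 k
  have hT : Continuous T := by fun_prop
  have hTW : ∀ (n : ℕ) ω, T (normMat (fun i : Fin n => X i ω) (fun i : Fin n => Y i ω) αx) =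
      scaledVec (fun i : Fin n => X i ω) (fun i : Fin n => Y i ω) αx Ψ₁ := fun n ω => by
    ext q
    rw [scaledVec_apply]
  have hvec : TendstoInDistribution
      (fun (n : ℕ) ω => scaledVec (fun i : Fin n => X i ω) (fun i : Fin n => Y i ω) αx Ψ₁)
      atTop id (fun _ => P) (multivariateGaussian 0 (omegaHd ν αx Ψ₁)) := by
    have h1 := hW.continuous_comp hT
    refine tendstoInDistribution_of_map_eq (h1.congr (fun n => ae_of_all _ (hTW n))
      (ae_of_all _ fun _ => rfl)) aemeasurable_id ?_
    rw [Measure.map_id, hΩ, ← map_multivariateGaussian_secondMoment hscore]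
    congr 1
    ext N q
    simp [T, linearForm, limitMap_apply]
  refine ⟨hpsd, hvec, ?_⟩
  -- the second assertion: the statistic is asymptotically the squared norm of `scaledVec`
  have hnorm := hvec.continuous_comp (continuous_norm.pow 2)
  have hTm : ∀ n : ℕ, AEMeasurable (fun ω =>
      condCoordStat (fun i : Fin n => X i ω) (fun i : Fin n => Y i ω) αx d) P := fun n => by
    simp_rw [condCoordStat_eq _ _ hdp hdh αx hαx]
    have hz := aemeasurable_zMat hlaw n
    have ha := aemeasurable_alphaOf (aemeasurable_covHat hlaw n) αx
    have hq := (by fun_prop : Continuous fun A : Matrix (Fin p) (Fin r) ℝ =>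
      1 - A * Aᵀ).measurable.comp_aemeasurable ha
    exact ((continuous_topEnergy.measurable.comp_aemeasurable hz).sub
      (continuous_topEnergy.measurable.comp_aemeasurable
        (aemeasurable_matrix_mul hq hz))).const_mul _
  obtain ⟨c, hc, hcs⟩ : ∃ c : ℝ, 0 < c ∧ ∀ i, c ≤ s i ^ 2 := by
    rcases isEmpty_or_nonempty (Fin d) with hem | hne
    · exact ⟨1, one_pos, fun i => hem.elim i⟩
    · obtain ⟨i₀, hi₀⟩ := Finite.exists_min fun i => s i ^ 2
      exact ⟨s i₀ ^ 2, pow_pos (hsvd.pos i₀) 2, hi₀⟩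
  have hδ := ae_tendsto_gramDist hmoments hcov hslices hlaw hindep hαx hαμ
  have hδm : ∀ n : ℕ, AEMeasurable (fun ω =>
      gramDist (zMat (fun i : Fin n => X i ω) fun i : Fin n => Y i ω) (muMat ν) +
      gramDist ((1 - alphaOf (covHat fun i : Fin n => X i ω) αx *
        (alphaOf (covHat fun i : Fin n => X i ω) αx)ᵀ) *
          zMat (fun i : Fin n => X i ω) fun i : Fin n => Y i ω) (muMat ν)) P := fun n => by
    have hz := aemeasurable_zMat hlaw n
    have ha := aemeasurable_alphaOf (aemeasurable_covHat hlaw n) αx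
    have hq := (by fun_prop : Continuous fun A : Matrix (Fin p) (Fin r) ℝ =>
      1 - A * Aᵀ).measurable.comp_aemeasurable ha
    have hg := (continuous_gramDist_left (muMat ν)).measurable
    exact (hg.comp_aemeasurable hz).add (hg.comp_aemeasurable (aemeasurable_matrix_mul hq hz))
  let bound : (Fin r → Fin h → ℝ) × ℝ → ℝ := fun z =>
    h ^ 2 * frobSq (Matrix.of z.1) * √(4 / c * z.2)
  have hbound : Continuous bound := by
    have h1 : Continuous fun z : (Fin r → Fin h → ℝ) × ℝ => frobSq (Matrix.of z.1) :=
      continuous_frobSq.comp continuous_fst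
    fun_prop
  have herr := hW.continuous_comp_prodMk_of_tendstoInMeasure_const hbound
    (tendstoInMeasure_of_tendsto_ae (fun n => (hδm n).aestronglyMeasurable) hδ) hδm
  simp only [bound, mul_zero, Real.sqrt_zero] at herr
  have hdiff := tendstoInMeasure_of_abs_le (fun n ω => abs_condCoordStat_sub_le hdp hdh hαx
    (fun i : Fin n => X i ω) (fun i : Fin n => Y i ω) hsvd.left hc hcs hsvd.right hsvd.eq_mul)
    (tendstoInMeasure_zero herr)
  have hstat := tendstoInDistribution_of_tendstoInMeasure_sub _ _ hnorm hdiff hTm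
  refine tendstoInDistribution_of_map_eq hstat (Finset.measurable_sum _ fun i _ =>
    (measurable_pi_apply i).const_mul _).aemeasurable ?_
  exact map_norm_sq_multivariateGaussian hpsd
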